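/- Let $d,s,n,N,K\ge 1$ be integers with $s>d/2$ and $N>\max\{5,2K\}$, and let $B,C>0$. Let $\mathbb{T}^d=(\mathbb{R}/\mathbb{Z})^d$ with normalized Lebesgue measure, $\varphi_m(x)=e^{2\pi i\langle m,x\rangle}$ for $m\in\mathbb{Z}^d$, and $\langle\varphi_{-m},u\rangle=\int_{\mathbb{T}^d}u(x)e^{-2\pi i\langle m,x\rangle}\,dx$. Let $H^s=H^s(\mathbb{T}^d,\mathbb{R})$ be the space of all $u\in L^2(\mathbb{T}^d,\mathbb{R})$ whose weak derivatives $\partial^k u$ lie in $L^2$ for all $k\in\mathbb{N}_0^d$ with $|k|_\infty\le s$, with norm $\|u\|_{H^s}^2=\sum_{|k|_\infty\le s}\|\partial^k u\|_{L^2}^2$; as $s>d/2$, its elements have continuous representatives, whose values are meant by $u(x)$. For bounded $\lambda:\mathbb{Z}^d\to\mathbb{C}$ let $T_\lambda v=\sum_{m\in\mathbb{Z}^d}\lambda_m\langle\varphi_{-m},v\rangle\varphi_m$ (convergence in $L^2$), and let $\mathcal{T}=\{T_\lambda:\sup_m|\lambda_m|\le C\}$. Let $\mu$ be a Borel probability measure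 on $H^s\times H^s$ such that $\|v\|_{H^s}\le B$ and $\|w\|_{H^s}\le B$ for $\mu$-almost every $(v,w)$, and let $S_n=((v_i,w_i))_{i\le n}\sim\mu^n$. For a function $u$ on the grid $G=\{j/N: j\in\{0,\dots,N-1\}^d\}$ put $\mathrm{DFT}(u)(-m)=N^{-d}\sum_{x\in G}u(x)e^{-2\pi i\langle x,m\rangle}$. Let $\widehat\lambda=(\widehat\lambda_m)_{|m|_\infty\le K}$ be any measurable function of the grid values of the sample that minimizes $$\frac1n\sum_{i=1}^n\sum_{|m|_\infty\le K}\bigl|\lambda_m\,\mathrm{DFT}(v_i|_G)(-m)-\mathrm{DFT}(w_i|_G)(-m)\bigr|^2$$ over all complex $(\lambda_m)_{|m|_\infty\le K}$ with $\max_m|\lambda_m|\le C$, and let $\widehat T_K^N v=\sum_{|m|_\infty\le K}\widehat\lambda_m\langle\varphi_{-m},v\rangle\varphi_m$. Then $\widehat T_K^N\in\mathcal{T}$, all the expectations below exist (the integrands are integrable), and the expected excess risk satisfies $$\mathbb{E}_{S_n\sim\mu^n}\Bigl[\mathbb{E}_{(v,w)\sim\mu}\|\widehat T_K^N v-w\|_{L^2}^2-\inf_{T\in\mathcal{T}}\mathbb{E}_{(v,w)\sim\mu}\|Tv-w\|_{L^2}^2\Bigr]\le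 8B^2(C+1)^2\left(\frac1{\sqrt n}+\frac{2^s\sqrt{\pi^d}}{N^s}+\frac1{K^{2s}}\right).$$ -/

import Mathlib

open MeasureTheory Set
open scoped ContDiff

/-! The torus `𝕋^d` is Mathlib's `UnitAddTorus (Fin d) = (ℝ/ℤ)^d`, with the normalized Haar
measure (Lebesgue measure on `[0,1]^d`) that Mathlib's multivariate Fourier series use. -/
attribute [local instance] instMeasureSpaceUnitAddCircle

namespace FourierLearning

/-- `L²(𝕋^d, ℝ)`. -/
abbrev L2R (d : ℕ) : Type := Lp ℝ 2 (volume : Measure (UnitAddTorus (Fin d)))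

/-- `L²(𝕋^d, ℂ)`. -/
abbrev L2C (d : ℕ) : Type := Lp ℂ 2 (volume : Measure (UnitAddTorus (Fin d)))

/-- The inclusion of `L²(𝕋^d, ℝ)` in `L²(𝕋^d, ℂ)`. -/
noncomputable def toComplex {d : ℕ} (u : L2R d) : L2C d := Complex.ofRealCLM.compLp u

/-! ### Sobolev spaces, through weak derivatives -/

/-- The classical partial derivative `∂_i φ` of a function on the torus. -/
noncomputable def partialDeriv {d : ℕ} (i : Fin d) (φ : UnitAddTorus (Fin d) → ℂ) :
    UnitAddTorus (Fin d) → ℂ :=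
  fun x => deriv (fun t : ℝ => φ (x + Pi.single i (t : UnitAddCircle))) 0

/-- The classical mixed derivative `∂^k φ` for a multi-index `k`. -/
noncomputable def mixedDeriv {d : ℕ} (k : Fin d → ℕ) (φ : UnitAddTorus (Fin d) → ℂ) :
    UnitAddTorus (Fin d) → ℂ :=
  (List.finRange d).foldr (fun i ψ => (partialDeriv i)^[k i] ψ) φ

/-- Smooth functions on the torus: those whose periodic lift to `ℝ^d` is `C^∞`. -/
def IsSmooth {d : ℕ} (φ : UnitAddTorus (Fin d) → ℂ) : Prop :=
  ContDiff ℝ ∞ (fun y : Fin d → ℝ => φ (fun i => (y i : UnitAddCircle)))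

/-- `g` is the weak derivative `∂^k u`:
`∫ u ∂^k φ = (-1)^{|k|₁} ∫ g φ` for every smooth `φ` on the torus. -/
def IsWeakDeriv {d : ℕ} (k : Fin d → ℕ) (u g : L2R d) : Prop :=
  ∀ φ : UnitAddTorus (Fin d) → ℂ, IsSmooth φ →
    ∫ x, (u x : ℂ) * mixedDeriv k φ x = (-1) ^ (∑ i, k i) * ∫ x, (g x : ℂ) * φ x

/-- The multi-indices `k ∈ ℕ₀^d` with `|k|_∞ ≤ s`. -/
def multiIndices (d s : ℕ) : Finset (Fin d → ℕ) :=
  Fintype.piFinset fun _ => Finset.range (s + 1)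

/-- The Sobolev space `H^s(𝕋^d, ℝ)`: the functions in `L²` all of whose weak derivatives `∂^k u`,
`|k|_∞ ≤ s`, are in `L²`. -/
def SobolevSet (d s : ℕ) : Set (L2R d) :=
  {u | ∀ k ∈ multiIndices d s, ∃ g : L2R d, IsWeakDeriv k u g}

/-- The type of elements of `H^s(𝕋^d, ℝ)`. -/
def Hs (d s : ℕ) : Type := SobolevSet d s

/-- The `L²` class of an element of `H^s`. -/
def Hs.toL2 {d s : ℕ} (u : Hs d s) : L2R d := Subtype.val u

/-- The `σ`-algebra on `H^s`: the trace of the Borel `σ`-algebra of `L²`. It coincides with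
the Borel `σ`-algebra of the `H^s`-norm, since `H^s` is separable and complete and its inclusion
in `L²` is continuous and injective. -/
noncomputable instance (d s : ℕ) : MeasurableSpace (Hs d s) := (borel (L2R d)).comap Hs.toL2

open Classical in
/-- The weak derivative `∂^k u` (and `0` if there is none in `L²`). -/
noncomputable def weakDeriv {d : ℕ} (k : Fin d → ℕ) (u : L2R d) : L2R d :=
  if h : ∃ g : L2R d, IsWeakDeriv k u g then h.choose else 0

/-- The norm of `H^s`: `‖u‖² = ∑_{|k|_∞ ≤ s} ‖∂^k u‖²_{L²}`. -/
noncomputable def Hs.sobolevNorm {d s : ℕ} (u : Hs d s) : ℝ :=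
  Real.sqrt (∑ k ∈ multiIndices d s, ‖weakDeriv k u.toL2‖ ^ 2)

/-! ### Fourier multipliers -/

/-- `⟨φ_{-m}, u⟩ = ∫ u(x) e^{-2πi⟨m,x⟩} dx`. -/
noncomputable def fourierCoeff {d : ℕ} (u : L2R d) (m : Fin d → ℤ) : ℂ :=
  UnitAddTorus.mFourierCoeff (fun x => (u x : ℂ)) m

/-- The operator `∑_{m ∈ ℤ^d} λ_m φ_m ⊗ φ_{-m}`, that is `v ↦ ∑_m λ_m ⟨φ_{-m}, v⟩ φ_m`, with
convergence in `L²`. -/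
noncomputable def multiplier {d : ℕ} (lam : (Fin d → ℤ) → ℂ) (v : L2R d) : L2C d :=
  ∑' m : Fin d → ℤ, (lam m * fourierCoeff v m) • UnitAddTorus.mFourierLp 2 m

/-- The class `𝒯 = {∑_m λ_m φ_m ⊗ φ_{-m} : |λ|_{ℓ^∞} ≤ C}`. -/
def multiplierClass (d : ℕ) (C : ℝ) : Set (L2R d → L2C d) :=
  {T | ∃ lam : (Fin d → ℤ) → ℂ, (∀ m, ‖lam m‖ ≤ C) ∧ T = multiplier lam}

/-- The low modes `ℤ^d_{≤ K} = {m : |m|_∞ ≤ K}`. -/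
noncomputable def modes (d K : ℕ) : Finset (Fin d → ℤ) :=
  Fintype.piFinset fun _ => Finset.Icc (-(K : ℤ)) K

/-- The truncated operator `∑_{m ∈ ℤ^d_{≤ K}} λ_m φ_m ⊗ φ_{-m}`. -/
noncomputable def truncatedMultiplier {d K : ℕ} (lam : modes d K → ℂ) (v : L2R d) : L2C d :=
  ∑ m : modes d K, (lam m * fourierCoeff v m) • UnitAddTorus.mFourierLp 2 (m : Fin d → ℤ)

/-! ### Grid values, discrete Fourier transform, and the estimator -/

open Classical in
/-- The value at `x` of the continuous representative of `u` (and `0` if there is none). -/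
noncomputable def pointValue {d : ℕ} (u : L2R d) (x : UnitAddTorus (Fin d)) : ℝ :=
  if h : ∃ f : C(UnitAddTorus (Fin d), ℝ), u =ᵐ[volume] f then h.choose x else 0

/-- Functions on the uniform grid `{j/N : j ∈ {0, …, N-1}^d}`. -/
abbrev GridFun (d N : ℕ) : Type := (Fin d → Fin N) → ℝ

/-- The restriction `u^N` of a function to the uniform grid. -/
noncomputable def gridValues {d : ℕ} (N : ℕ) (u : L2R d) : GridFun d N :=
  fun j => pointValue u (fun i => (((j i : ℕ) : ℝ) / (N : ℝ) : ℝ))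

/-- `DFT(a)(k) = N^{-d} ∑_{x} a(x) e^{2πi⟨x,k⟩}`, the sum being over the grid points `x = j/N`. -/
noncomputable def DFT {d N : ℕ} (a : GridFun d N) (k : Fin d → ℤ) : ℂ :=
  1 / (N : ℂ) ^ d * ∑ j : Fin d → Fin N,
    (a j : ℂ) * Complex.exp (2 * Real.pi * Complex.I * ∑ i, ((j i : ℕ) : ℂ) / (N : ℂ) * (k i : ℂ))

/-- The DFT-based empirical least-squares objective of a multiplier `λ` on `ℤ^d_{≤ K}`. -/
noncomputable def objective {d n N K : ℕ} (D : Fin n → GridFun d N × GridFun d N)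
    (lam : modes d K → ℂ) : ℝ :=
  1 / (n : ℝ) * ∑ i : Fin n, ∑ m : modes d K,
    ‖lam m * DFT (D i).1 (-(m : Fin d → ℤ)) - DFT (D i).2 (-(m : Fin d → ℤ))‖ ^ 2

/-- `λ̂` minimizes the objective for the data `D` subject to `sup_m |λ_m| ≤ C`. -/
def IsConstrainedLeastSquares {d n N K : ℕ} (C : ℝ) (D : Fin n → GridFun d N × GridFun d N)
    (lamHat : modes d K → ℂ) : Prop :=
  (∀ m, ‖lamHat m‖ ≤ C) ∧
    ∀ lam : modes d K → ℂ, (∀ m, ‖lam m‖ ≤ C) → objective D lamHat ≤ objective D lam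

/-- The grid data of a sample of `n` pairs of functions. -/
noncomputable def gridData {d s n : ℕ} (N : ℕ) (S : Fin n → Hs d s × Hs d s) :
    Fin n → GridFun d N × GridFun d N :=
  fun i => (gridValues N (S i).1.toL2, gridValues N (S i).2.toL2)

/-- The estimator `T̂_K^N`: the truncated operator whose coefficients `lamHat` computes from the
grid data of the sample. -/
noncomputable def estimator {d s n N K : ℕ}
    (lamHat : (Fin n → GridFun d N × GridFun d N) → modes d K → ℂ)
    (S : Fin n → Hs d s × Hs d s) : L2R d → L2C d :=
  truncatedMultiplier (lamHat (gridData N S))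

/-! ### Risk -/

/-- The squared loss `‖Tv - w‖²_{L²}`. -/
noncomputable def loss {d s : ℕ} (T : L2R d → L2C d) (p : Hs d s × Hs d s) : ℝ :=
  ‖T p.1.toL2 - toComplex p.2.toL2‖ ^ 2

/-- The risk `E_{(v,w) ∼ μ} ‖Tv - w‖²_{L²}`. -/
noncomputable def risk {d s : ℕ} (μ : Measure (Hs d s × Hs d s)) (T : L2R d → L2C d) : ℝ :=
  ∫ p, loss T p ∂μ

/-- The excess risk of `T` over the class `𝒯`. -/
noncomputable def excessRisk {d s : ℕ} (μ : Measure (Hs d s × Hs d s))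
    (𝒯 : Set (L2R d → L2C d)) (T : L2R d → L2C d) : ℝ :=
  risk μ T - ⨅ T' : 𝒯, risk μ T'

/-- The expected excess risk `ℰ_n(T̂, 𝒯, μ)` over `n` independent samples from `μ`. -/
noncomputable def expectedExcessRisk {d s : ℕ} (n : ℕ) (μ : Measure (Hs d s × Hs d s))
    (𝒯 : Set (L2R d → L2C d)) (That : (Fin n → Hs d s × Hs d s) → L2R d → L2C d) : ℝ :=
  ∫ S, excessRisk μ 𝒯 (That S) ∂(Measure.pi fun _ : Fin n => μ)

end FourierLearning

namespace FourierLearning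
open UnitAddTorus

instance : Measure.IsAddHaarMeasure (volume : Measure UnitAddCircle) :=
  inferInstanceAs (Measure.IsAddHaarMeasure AddCircle.haarAddCircle)

instance : IsProbabilityMeasure (volume : Measure UnitAddCircle) :=
  inferInstanceAs (IsProbabilityMeasure AddCircle.haarAddCircle)

theorem toComplex_ae {d : ℕ} (u : L2R d) : toComplex u =ᵐ[volume] fun x => (u x : ℂ) :=
  Complex.ofRealCLM.coeFn_compLp u

theorem mFourierCoeff_toComplex {d : ℕ} (u : L2R d) (m : Fin d → ℤ) :
    mFourierCoeff (toComplex u) m = fourierCoeff u m := by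
  apply integral_congr_ae
  filter_upwards [toComplex_ae u] with x hx
  simp only [hx]

theorem norm_toComplex {d : ℕ} (u : L2R d) : ‖toComplex u‖ = ‖u‖ := by
  apply le_antisymm <;> apply Lp.norm_le_norm_of_ae_le <;>
  · filter_upwards [toComplex_ae u] with x hx
    simp [hx]

theorem hasSum_sq_of_L2 {d : ℕ} (f : L2C d) :
    HasSum (fun m => ‖mFourierCoeff f m‖ ^ 2) (‖f‖ ^ 2) := by
  convert! hasSum_sq_mFourierCoeff f using 1
  rw [← @inner_self_eq_norm_sq ℂ, L2.inner_def, ← integral_re (L2.integrable_inner f f)]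
  refine integral_congr_ae (Filter.Eventually.of_forall fun x => ?_)
  simp only [inner_self_eq_norm_sq_to_K, ← RCLike.ofReal_pow, RCLike.ofReal_re]

theorem hasSum_sq_fourierCoeff {d : ℕ} (u : L2R d) :
    HasSum (fun m => ‖fourierCoeff u m‖ ^ 2) (‖u‖ ^ 2) := by
  simpa only [mFourierCoeff_toComplex, norm_toComplex] using hasSum_sq_of_L2 (toComplex u)

theorem mFourier_coe {d : ℕ} (m : Fin d → ℤ) (y : Fin d → ℝ) :
    mFourier m (fun i => (y i : UnitAddCircle)) =
      Complex.exp (2 * Real.pi * Complex.I * ∑ i, (m i : ℂ) * (y i : ℂ)) := by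
  rw [Finset.mul_sum, Complex.exp_sum]
  simp only [mFourier, ContinuousMap.coe_mk, fourier_coe_apply]
  refine Finset.prod_congr rfl fun i _ => ?_
  congr 1
  push_cast
  ring

theorem isSmooth_mFourier {d : ℕ} (m : Fin d → ℤ) : IsSmooth (mFourier m) := by
  unfold IsSmooth
  simp only [mFourier_coe]
  have h : ∀ i, ContDiff ℝ ∞ (fun y : Fin d → ℝ => (y i : ℂ)) := fun i =>
    Complex.ofRealCLM.contDiff.comp (contDiff_apply ℝ ℝ i)
  fun_prop

theorem partialDeriv_mFourier {d : ℕ} (i : Fin d) (m : Fin d → ℤ) (c : ℂ) :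
    partialDeriv i (fun x => c * mFourier m x) =
      fun x => (c * (2 * Real.pi * Complex.I * m i)) * mFourier m x := by
  funext x
  have h : ∀ t : ℝ, c * mFourier m (x + Pi.single i (t : UnitAddCircle)) =
      c * (mFourier m x * Complex.exp (2 * Real.pi * Complex.I * m i * t)) := by
    intro t
    have h1 : mFourier m (x + Pi.single i (t : UnitAddCircle)) =
        mFourier m x * mFourier m (fun j => ((Pi.single i t : Fin d → ℝ) j : UnitAddCircle)) := by
      simp only [mFourier, ContinuousMap.coe_mk, ← Finset.prod_mul_distrib]
      refine Finset.prod_congr rfl fun j _ => ?_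
      have : (x + Pi.single i (t : UnitAddCircle) : UnitAddTorus (Fin d)) j =
          x j + ((Pi.single i t : Fin d → ℝ) j : UnitAddCircle) := by
        by_cases hj : j = i
        · subst hj; simp
        · simp [hj]
      rw [this, fourier_apply, fourier_apply, fourier_apply, smul_add, AddCircle.toCircle_add]
      simp
    rw [h1, mFourier_coe]
    congr 3
    rw [mul_assoc (2 * Real.pi * Complex.I)]
    congr 1
    rw [Finset.sum_eq_single i]
    · simp
    · intro j _ hj; simp [hj]
    · simp
  unfold partialDeriv
  simp only [h]
  have h2 : HasDerivAt (fun t : ℝ => Complex.exp (2 * Real.pi * Complex.I * m i * t))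
      (Complex.exp (2 * Real.pi * Complex.I * m i * (0:ℝ)) * (2 * Real.pi * Complex.I * m i * 1)) 0 :=
    ((Complex.ofRealCLM.hasDerivAt (x := 0)).const_mul (2 * Real.pi * Complex.I * m i)).cexp
  have h3 := ((h2.const_mul (mFourier m x)).const_mul c).deriv
  rw [h3]
  simp
  ring

theorem iterate_partialDeriv_mFourier {d : ℕ} (i : Fin d) (m : Fin d → ℤ) (c : ℂ) (k : ℕ) :
    (partialDeriv i)^[k] (fun x => c * mFourier m x) =
      fun x => (c * (2 * Real.pi * Complex.I * m i) ^ k) * mFourier m x := by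
  induction k with
  | zero => simp
  | succ k ih =>
    rw [Function.iterate_succ_apply', ih, partialDeriv_mFourier]
    funext x
    ring

theorem mixedDeriv_mFourier {d : ℕ} (k : Fin d → ℕ) (m : Fin d → ℤ) :
    mixedDeriv k (mFourier m) =
      fun x => (∏ i, (2 * Real.pi * Complex.I * m i) ^ k i) * mFourier m x := by
  have key : ∀ l : List (Fin d), l.foldr (fun i ψ => (partialDeriv i)^[k i] ψ) (mFourier m) =
      fun x => (l.map fun i => (2 * Real.pi * Complex.I * m i) ^ k i).prod * mFourier m x := by
    intro l
    induction l with
    | nil => simp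
    | cons a l ih =>
      rw [List.foldr_cons, ih, iterate_partialDeriv_mFourier]
      funext x
      simp only [List.map_cons, List.prod_cons]
      ring
  unfold mixedDeriv
  rw [key]
  simp only [← List.ofFn_eq_map, List.prod_ofFn]

theorem IsWeakDeriv.fourierCoeff_eq {d : ℕ} {k : Fin d → ℕ} {u g : L2R d} (h : IsWeakDeriv k u g)
    (m : Fin d → ℤ) :
    fourierCoeff g m = (∏ i, (2 * Real.pi * Complex.I * m i) ^ k i) * fourierCoeff u m := by
  have h1 := h _ (isSmooth_mFourier (-m))
  rw [mixedDeriv_mFourier] at h1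
  have hu : ∫ x, (u x : ℂ) * ((∏ i, (2 * Real.pi * Complex.I * ((-m) i : ℤ)) ^ k i)
      * mFourier (-m) x) =
      (∏ i, (2 * Real.pi * Complex.I * ((-m) i : ℤ)) ^ k i) * fourierCoeff u m := by
    unfold fourierCoeff mFourierCoeff
    rw [← integral_const_mul]
    congr 1
    funext x
    simp only [smul_eq_mul]
    ring
  have hg : ∫ x, (g x : ℂ) * mFourier (-m) x = fourierCoeff g m := by
    unfold fourierCoeff mFourierCoeff
    simp only [smul_eq_mul, mul_comm]
  rw [hu, hg] at h1
  have h2 : ∏ i, (2 * Real.pi * Complex.I * ((-m) i : ℤ)) ^ k i =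
      (-1) ^ (∑ i, k i) * ∏ i, (2 * Real.pi * Complex.I * m i) ^ k i := by
    rw [← Finset.prod_pow_eq_pow_sum, ← Finset.prod_mul_distrib]
    refine Finset.prod_congr rfl fun i _ => ?_
    rw [← mul_pow]
    simp
  rw [h2, mul_assoc] at h1
  exact (mul_left_cancel₀ (pow_ne_zero _ (by norm_num)) h1).symm

/-- The Sobolev weight `∑_{|k|_∞ ≤ s} ∏ᵢ (2πmᵢ)^{2kᵢ}` of a frequency, as a product. -/
noncomputable def weight {d : ℕ} (s : ℕ) (m : Fin d → ℤ) : ℝ :=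
  ∏ i, ∑ j ∈ Finset.range (s + 1), (2 * Real.pi * |(m i : ℝ)|) ^ (2 * j)

theorem Hs.hasSum_weight {d s : ℕ} (u : Hs d s) :
    HasSum (fun m => weight s m * ‖fourierCoeff u.toL2 m‖ ^ 2) (u.sobolevNorm ^ 2) := by
  have h : ∀ k ∈ multiIndices d s, HasSum (fun m : Fin d → ℤ =>
      (∏ i, (2 * Real.pi * |(m i : ℝ)|) ^ (2 * k i)) * ‖fourierCoeff u.toL2 m‖ ^ 2)
      (‖weakDeriv k u.toL2‖ ^ 2) := by
    intro k hk
    have hex := u.2 k hk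
    have hw : IsWeakDeriv k u.toL2 (weakDeriv k u.toL2) := by
      unfold weakDeriv
      rw [dif_pos (by exact hex)]
      exact hex.choose_spec
    convert! hasSum_sq_fourierCoeff (weakDeriv k u.toL2) using 2 with m
    rw [hw.fourierCoeff_eq, norm_mul, mul_pow, norm_prod, ← Finset.prod_pow]
    congr 1
    refine Finset.prod_congr rfl fun i _ => ?_
    rw [norm_pow, pow_mul', ← pow_mul, pow_mul', ← pow_mul]
    simp [abs_of_pos Real.pi_pos, ← pow_mul, mul_comm (k i)]
  have := hasSum_sum h
  unfold Hs.sobolevNorm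
  rw [Real.sq_sqrt (Finset.sum_nonneg fun _ _ => sq_nonneg _)]
  convert! this using 2 with m
  rw [← Finset.sum_mul]
  congr 1
  unfold weight multiIndices
  rw [Finset.prod_univ_sum]

/-- The function `p ↦ p⁻²` on the integers, with the value `1` at `0`. -/
noncomputable def invSq (p : ℤ) : ℝ := if p = 0 then 1 else 1 / (p : ℝ) ^ 2

theorem invSq_nonneg (p : ℤ) : 0 ≤ invSq p := by
  unfold invSq; split_ifs <;> positivity

theorem sum_invSq_le (F : Finset ℤ) : ∑ p ∈ F, invSq p ≤ 5 := by
  have h1 : HasSum (fun n : ℕ => invSq n) (Real.pi ^ 2 / 6 + 1) := by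
    convert! hasSum_zeta_two.add (hasSum_ite_eq (0 : ℕ) (1 : ℝ)) using 2 with n
    unfold invSq
    by_cases hn : n = 0 <;> simp [hn]
  have h2 : HasSum (fun n : ℕ => invSq (-(n + 1 : ℤ))) (Real.pi ^ 2 / 6) := by
    have := (hasSum_nat_add_iff' (f := fun n : ℕ => 1 / (n : ℝ) ^ 2) 1).mpr hasSum_zeta_two
    simp only [Finset.range_one, Finset.sum_singleton, CharP.cast_eq_zero, ne_eq,
      OfNat.ofNat_ne_zero, not_false_eq_true, zero_pow, div_zero, sub_zero] at this
    convert! this using 2 with n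
    unfold invSq
    rw [if_neg (by omega)]
    congr 1
    push_cast
    ring
  have h3 := HasSum.of_nat_of_neg_add_one h1 h2
  refine (sum_le_hasSum F (fun p _ => invSq_nonneg p) h3).trans ?_
  nlinarith [Real.pi_gt_three, Real.pi_lt_d2]

theorem sum_prod_invSq_le {d : ℕ} (F : Finset (Fin d → ℤ)) :
    ∑ p ∈ F, ∏ i, invSq (p i) ≤ 5 ^ d := by
  classical
  have hsub : F ⊆ Fintype.piFinset fun i => F.image fun p => p i := fun p hp =>
    Fintype.mem_piFinset.mpr fun i => Finset.mem_image_of_mem _ hp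
  calc ∑ p ∈ F, ∏ i, invSq (p i)
      ≤ ∑ p ∈ Fintype.piFinset fun i => F.image fun p => p i, ∏ i, invSq (p i) :=
        Finset.sum_le_sum_of_subset_of_nonneg hsub fun p _ _ =>
          Finset.prod_nonneg fun _ _ => invSq_nonneg _
    _ = ∏ i, ∑ x ∈ F.image fun p => p i, invSq x := (Finset.prod_univ_sum _ _).symm
    _ ≤ ∏ _i : Fin d, 5 := Finset.prod_le_prod
        (fun i _ => Finset.sum_nonneg fun _ _ => invSq_nonneg _) fun i _ => sum_invSq_le _
    _ = 5 ^ d := by simp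

theorem summable_prod_invSq (d : ℕ) : Summable fun p : Fin d → ℤ => ∏ i, invSq (p i) :=
  summable_of_sum_le (fun _ => Finset.prod_nonneg fun _ _ => invSq_nonneg _) sum_prod_invSq_le

theorem tsum_prod_invSq_le (d : ℕ) : ∑' p : Fin d → ℤ, ∏ i, invSq (p i) ≤ 5 ^ d :=
  Real.tsum_le_of_sum_le (fun _ => Finset.prod_nonneg fun _ _ => invSq_nonneg _) sum_prod_invSq_le

theorem one_le_weight_factor (s : ℕ) (x : ℝ) :
    1 ≤ ∑ j ∈ Finset.range (s + 1), x ^ (2 * j) := by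
  rw [Finset.sum_range_succ']
  have : 0 ≤ ∑ k ∈ Finset.range s, x ^ (2 * (k + 1)) :=
    Finset.sum_nonneg fun k _ => by rw [pow_mul]; positivity
  simpa using this

theorem pow_le_weight_factor (s : ℕ) (x : ℝ) :
    x ^ (2 * s) ≤ ∑ j ∈ Finset.range (s + 1), x ^ (2 * j) :=
  Finset.single_le_sum (f := fun j => x ^ (2 * j)) (fun k _ => by rw [pow_mul]; positivity)
    (Finset.self_mem_range_succ s)

theorem one_le_prod_weight_factor {ι : Type*} (F : Finset ι) (s : ℕ) (x : ι → ℝ) :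
    1 ≤ ∏ i ∈ F, ∑ j ∈ Finset.range (s + 1), x i ^ (2 * j) := by
  exact Finset.one_le_prod fun i _ => one_le_weight_factor s (x i)

theorem one_le_weight {d : ℕ} (s : ℕ) (m : Fin d → ℤ) : 1 ≤ weight s m :=
  one_le_prod_weight_factor _ _ _

theorem weight_pos {d : ℕ} (s : ℕ) (m : Fin d → ℤ) : 0 < weight s m :=
  zero_lt_one.trans_le (one_le_weight s m)

theorem pow_le_weight {d : ℕ} (s : ℕ) (m : Fin d → ℤ) (i : Fin d) :
    (2 * Real.pi * |(m i : ℝ)|) ^ (2 * s) ≤ weight s m := by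
  classical
  refine (pow_le_weight_factor s _).trans ?_
  unfold weight
  rw [← Finset.mul_prod_erase _ _ (Finset.mem_univ i)]
  refine le_mul_of_one_le_right (zero_le_one.trans (one_le_weight_factor _ _)) ?_
  exact one_le_prod_weight_factor _ _ _

theorem inv_weight_le {d s : ℕ} (hs : 1 ≤ s) {κ : ℝ} (hκ : 1 ≤ κ) {m p : Fin d → ℤ} (hp : p ≠ 0)
    (h : ∀ i, κ * |(p i : ℝ)| ≤ 2 * Real.pi * |(m i : ℝ)|) :
    (weight s m)⁻¹ ≤ (κ ^ (2 * s))⁻¹ * ∏ i, invSq (p i) := by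
  classical
  obtain ⟨i₀, hi₀⟩ := Function.ne_iff.mp hp
  have hc : (κ ^ (2 * s))⁻¹ ≤ 1 := inv_le_one_of_one_le₀ (one_le_pow₀ hκ)
  have key : ∀ i, (∑ j ∈ Finset.range (s + 1), (2 * Real.pi * |(m i : ℝ)|) ^ (2 * j))⁻¹ ≤
      (if i = i₀ then (κ ^ (2 * s))⁻¹ else 1) * invSq (p i) := by
    intro i
    by_cases hpi : p i = 0
    · have : i ≠ i₀ := by rintro rfl; exact hi₀ hpi
      simp only [this, if_false, hpi, invSq, if_true, mul_one]
      exact inv_le_one_of_one_le₀ (one_le_weight_factor _ _)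
    · have hp1 : (1 : ℝ) ≤ |(p i : ℝ)| := by exact_mod_cast Int.one_le_abs hpi
      have h1 : κ ^ (2 * s) * (p i : ℝ) ^ 2 ≤
          ∑ j ∈ Finset.range (s + 1), (2 * Real.pi * |(m i : ℝ)|) ^ (2 * j) := by
        refine le_trans ?_ (pow_le_weight_factor s _)
        calc κ ^ (2 * s) * (p i : ℝ) ^ 2 = κ ^ (2 * s) * |(p i : ℝ)| ^ 2 := by rw [sq_abs]
          _ ≤ κ ^ (2 * s) * |(p i : ℝ)| ^ (2 * s) := by
              refine mul_le_mul_of_nonneg_left (pow_le_pow_right₀ hp1 (by omega)) (by positivity)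
          _ = (κ * |(p i : ℝ)|) ^ (2 * s) := (mul_pow _ _ _).symm
          _ ≤ _ := pow_le_pow_left₀ (by positivity) (h i) _
      have hpos : 0 < κ ^ (2 * s) * (p i : ℝ) ^ 2 := by
        have : (p i : ℝ) ≠ 0 := by exact_mod_cast hpi
        positivity
      have h2 := inv_anti₀ hpos h1
      rw [mul_inv] at h2
      have h3 : (κ ^ (2 * s))⁻¹ ≤ (if i = i₀ then (κ ^ (2 * s))⁻¹ else 1) := by
        split_ifs
        · exact le_rfl
        · exact hc
      refine h2.trans ?_
      simp only [invSq, hpi, if_false, one_div]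
      gcongr
  unfold weight
  rw [← Finset.prod_inv_distrib]
  refine (Finset.prod_le_prod (fun i _ => ?_) fun i _ => key i).trans ?_
  · exact inv_nonneg.mpr (zero_le_one.trans (one_le_weight_factor _ _))
  · rw [Finset.prod_mul_distrib, Finset.prod_ite_eq' Finset.univ i₀]
    simp

theorem inv_weight_le_single {d s : ℕ} (hs : 1 ≤ s) (m : Fin d → ℤ) :
    (weight s m)⁻¹ ≤
      (if m = 0 then 1 else 0) + ((2 * Real.pi) ^ (2 * s))⁻¹ * ∏ i, invSq (m i) := by
  have hpi := Real.pi_gt_three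
  by_cases hm : m = 0
  · rw [if_pos hm]
    have h1 : (weight s m)⁻¹ ≤ 1 := inv_le_one_of_one_le₀ (one_le_weight s m)
    have h2 : 0 ≤ ((2 * Real.pi) ^ (2 * s))⁻¹ * ∏ i, invSq (m i) :=
      mul_nonneg (by positivity) (Finset.prod_nonneg fun _ _ => invSq_nonneg _)
    linarith
  · rw [if_neg hm, zero_add]
    exact inv_weight_le hs (by linarith) hm fun i => le_rfl

theorem summable_inv_weight {d s : ℕ} (hs : 1 ≤ s) :
    Summable fun m : Fin d → ℤ => (weight s m)⁻¹ :=
  Summable.of_nonneg_of_le (fun m => (inv_pos.mpr (weight_pos s m)).le) (inv_weight_le_single hs)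
    ((hasSum_ite_eq 0 1).summable.add ((summable_prod_invSq d).mul_left _))

theorem tsum_inv_weight_le {d s : ℕ} (hs : 1 ≤ s) (hds : d ≤ 2 * s) :
    ∑' m : Fin d → ℤ, (weight s m)⁻¹ ≤ 2 := by
  have hpi := Real.pi_gt_three
  refine ((summable_inv_weight hs).tsum_le_tsum (inv_weight_le_single hs)
    ((hasSum_ite_eq 0 1).summable.add ((summable_prod_invSq d).mul_left _))).trans ?_
  rw [(hasSum_ite_eq (0 : Fin d → ℤ) (1 : ℝ)).summable.tsum_add
    ((summable_prod_invSq d).mul_left _), tsum_ite_eq, tsum_mul_left]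
  have h1 : (5 : ℝ) ^ d ≤ (2 * Real.pi) ^ (2 * s) :=
    (pow_le_pow_right₀ (by norm_num) hds).trans (by gcongr; linarith)
  have h2 : ((2 * Real.pi) ^ (2 * s))⁻¹ * ∑' p : Fin d → ℤ, ∏ i, invSq (p i) ≤ 1 := by
    rw [inv_mul_le_iff₀ (by positivity), mul_one]
    exact (tsum_prod_invSq_le d).trans h1
  linarith

theorem mem_modes {d K : ℕ} {m : Fin d → ℤ} : m ∈ modes d K ↔ ∀ i, |m i| ≤ K := by
  simp [modes, abs_le]

/-- The frequency `m + N p` aliased to `m` on the grid of mesh `1 / N`. -/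
def aliasShift {d : ℕ} (N : ℕ) (m p : Fin d → ℤ) : Fin d → ℤ := fun i => m i + N * p i

theorem aliasShift_injective {d N : ℕ} (hN : 1 ≤ N) (m : Fin d → ℤ) :
    Function.Injective (aliasShift N m) := by
  intro p q h
  funext i
  have := congrFun h i
  simp only [aliasShift, add_right_inj] at this
  exact mul_left_cancel₀ (by omega) this

theorem inv_weight_aliasShift_le {d s N K : ℕ} (hs : 1 ≤ s) (hN : 1 ≤ N) (hK : 2 * K < N)
    {m : Fin d → ℤ} (hm : m ∈ modes d K) {p : Fin d → ℤ} (hp : p ≠ 0) :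
    (weight s (aliasShift N m p))⁻¹ ≤ ((Real.pi * N) ^ (2 * s))⁻¹ * ∏ i, invSq (p i) := by
  have hpi := Real.pi_gt_three
  have hN' : (1 : ℝ) ≤ N := by exact_mod_cast hN
  refine inv_weight_le hs (by nlinarith) hp fun i => ?_
  by_cases hpi0 : p i = 0
  · simp only [hpi0, Int.cast_zero, abs_zero, mul_zero]
    positivity
  have h1 : (1 : ℝ) ≤ |(p i : ℝ)| := by exact_mod_cast Int.one_le_abs hpi0
  have h2 : |(m i : ℝ)| ≤ K := by exact_mod_cast mem_modes.mp hm i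
  have h3 : (2 : ℝ) * K ≤ N := by exact_mod_cast hK.le
  have h4 : (N : ℝ) * |(p i : ℝ)| - |(m i : ℝ)| ≤ |((aliasShift N m p i : ℤ) : ℝ)| := by
    have := abs_sub_abs_le_abs_sub ((N : ℝ) * p i) (-(m i : ℝ))
    rw [abs_mul, abs_neg, Nat.abs_cast, sub_neg_eq_add, add_comm (_ * _) (m i : ℝ)] at this
    simpa [aliasShift] using this
  have h5 : (N : ℝ) * |(p i : ℝ)| ≤ 2 * |((aliasShift N m p i : ℤ) : ℝ)| := by nlinarith
  nlinarith

theorem summable_norm_of_weighted {ι : Type*} {a : ι → ℂ} {w : ι → ℝ} (hw : ∀ i, 0 < w i)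
    (h1 : Summable fun i => (w i)⁻¹) (h2 : Summable fun i => w i * ‖a i‖ ^ 2) :
    Summable (fun i => ‖a i‖) ∧
      (∑' i, ‖a i‖) ^ 2 ≤ (∑' i, (w i)⁻¹) * ∑' i, w i * ‖a i‖ ^ 2 := by
  have key : ∀ F : Finset ι, ∑ i ∈ F, ‖a i‖ ≤
      Real.sqrt ((∑' i, (w i)⁻¹) * ∑' i, w i * ‖a i‖ ^ 2) := by
    intro F
    apply Real.le_sqrt_of_sq_le
    have hnn : ∀ i, 0 ≤ w i * ‖a i‖ ^ 2 := fun i => mul_nonneg (hw i).le (sq_nonneg _)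
    have hin : ∀ i, 0 ≤ (w i)⁻¹ := fun i => (inv_pos.mpr (hw i)).le
    refine (Finset.sum_sq_le_sum_mul_sum_of_sq_le_mul F (f := fun i => (w i)⁻¹)
      (g := fun i => w i * ‖a i‖ ^ 2) (fun i _ => hin i) (fun i _ => hnn i) fun i _ => ?_).trans ?_
    · rw [inv_mul_cancel_left₀ (hw i).ne']
    · exact mul_le_mul (h1.sum_le_tsum _ fun i _ => hin i) (h2.sum_le_tsum _ fun i _ => hnn i)
        (Finset.sum_nonneg fun i _ => hnn i) (tsum_nonneg hin)
  refine ⟨summable_of_sum_le (fun i => norm_nonneg _) key, ?_⟩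
  refine (Real.le_sqrt (tsum_nonneg fun i => norm_nonneg _) (mul_nonneg ?_ ?_)).mp
    (Real.tsum_le_of_sum_le (fun i => norm_nonneg _) key)
  · exact tsum_nonneg fun i => (inv_pos.mpr (hw i)).le
  · exact tsum_nonneg fun i => mul_nonneg (hw i).le (sq_nonneg _)

theorem Hs.summable_norm_fourierCoeff {d s : ℕ} (hs : 1 ≤ s) (u : Hs d s) :
    Summable fun m => ‖fourierCoeff u.toL2 m‖ :=
  (summable_norm_of_weighted (weight_pos s) (summable_inv_weight hs) u.hasSum_weight.summable).1

theorem Hs.summable_weight {d s : ℕ} (u : Hs d s) :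
    Summable fun m => weight s m * ‖fourierCoeff u.toL2 m‖ ^ 2 := u.hasSum_weight.summable

theorem Hs.hasSum_pointValue {d s : ℕ} (hs : 1 ≤ s) (u : Hs d s) (x : UnitAddTorus (Fin d)) :
    HasSum (fun m => fourierCoeff u.toL2 m * mFourier m x) (pointValue u.toL2 x : ℂ) := by
  have hsum : Summable fun m => fourierCoeff u.toL2 m • mFourier m := by
    refine .of_norm ?_
    simpa only [norm_smul, mFourier_norm, mul_one] using u.summable_norm_fourierCoeff hs
  set F : C(UnitAddTorus (Fin d), ℂ) := ∑' m, fourierCoeff u.toL2 m • mFourier m with hF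
  have hLp : ContinuousMap.toLp 2 volume ℂ F = toComplex u.toL2 := by
    have h1 := (ContinuousMap.toLp (E := ℂ) 2 (volume : Measure (UnitAddTorus (Fin d))) ℂ).hasSum
      hsum.hasSum
    have h2 := hasSum_mFourier_series_L2 (toComplex u.toL2)
    simp only [mFourierCoeff_toComplex] at h2
    refine h1.unique ?_
    simpa only [Function.comp_def, map_smul] using h2
  have hae : (fun x => (u.toL2 x : ℂ)) =ᵐ[volume] F := by
    refine (toComplex_ae u.toL2).symm.trans ?_
    rw [← hLp]
    exact ContinuousMap.coeFn_toLp volume F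
  have hex : ∃ f : C(UnitAddTorus (Fin d), ℝ), u.toL2 =ᵐ[volume] f := by
    refine ⟨⟨fun x => (F x).re, by fun_prop⟩, ?_⟩
    filter_upwards [hae] with x hx
    simp [← hx]
  have heq : (fun x => (pointValue u.toL2 x : ℂ)) = F := by
    unfold pointValue
    simp only [dif_pos hex]
    refine (Continuous.ae_eq_iff_eq volume (by fun_prop) F.continuous).mp ?_
    refine Filter.EventuallyEq.trans ?_ hae
    filter_upwards [hex.choose_spec] with x hx
    rw [hx]
  rw [show (pointValue u.toL2 x : ℂ) = F x from congrFun heq x]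
  simpa using! (ContinuousMap.evalCLM ℂ x).hasSum hsum.hasSum

theorem sum_exp_eq_ite {N : ℕ} (hN : 1 ≤ N) (q : ℤ) :
    ∑ j : Fin N, Complex.exp (2 * Real.pi * Complex.I * (((j : ℕ) : ℂ) / N * q)) =
      if (N : ℤ) ∣ q then (N : ℂ) else 0 := by
  have hN0 : N ≠ 0 := by omega
  have hNC : (N : ℂ) ≠ 0 := by exact_mod_cast hN0
  have hζ := Complex.isPrimitiveRoot_exp N hN0
  set ζ := Complex.exp (2 * Real.pi * Complex.I / N) with hζd
  have hterm : ∀ j : Fin N, Complex.exp (2 * Real.pi * Complex.I * (((j : ℕ) : ℂ) / N * q)) =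
      (ζ ^ q) ^ (j : ℕ) := by
    intro j
    rw [hζd, ← Complex.exp_int_mul, ← Complex.exp_nat_mul]
    congr 1
    ring
  simp only [hterm]
  rw [Fin.sum_univ_eq_sum_range (fun j => (ζ ^ q) ^ j) N]
  split_ifs with h
  · rw [(hζ.zpow_eq_one_iff_dvd q).mpr h]
    simp
  · have h1 : ζ ^ q ≠ 1 := fun hh => h ((hζ.zpow_eq_one_iff_dvd q).mp hh)
    rw [geom_sum_eq h1, ← zpow_natCast, ← zpow_mul, mul_comm, zpow_mul, zpow_natCast, hζ.pow_eq_one]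
    simp

theorem sum_grid_exp {d N : ℕ} (hN : 1 ≤ N) (q : Fin d → ℤ) :
    1 / (N : ℂ) ^ d * ∑ j : Fin d → Fin N,
      Complex.exp (2 * Real.pi * Complex.I * ∑ i, ((j i : ℕ) : ℂ) / N * q i) =
      if ∀ i, (N : ℤ) ∣ q i then 1 else 0 := by
  have hNC : (N : ℂ) ≠ 0 := by exact_mod_cast (by omega : N ≠ 0)
  simp only [Finset.mul_sum (Finset.univ : Finset (Fin d)), Complex.exp_sum]
  rw [← Fintype.piFinset_univ, ← Finset.prod_univ_sum (fun _ => Finset.univ)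
    (fun i (x : Fin N) => Complex.exp (2 * Real.pi * Complex.I * (((x : ℕ) : ℂ) / N * q i)))]
  simp only [sum_exp_eq_ite hN]
  split_ifs with h
  · simp only [h, if_true, Finset.prod_const, Finset.card_univ, Fintype.card_fin]
    field_simp
  · push Not at h
    obtain ⟨i, hi⟩ := h
    rw [Finset.prod_eq_zero (Finset.mem_univ i) (if_neg hi), mul_zero]

theorem Hs.hasSum_DFT {d s N : ℕ} (hs : 1 ≤ s) (hN : 1 ≤ N) (u : Hs d s) (m : Fin d → ℤ) :
    HasSum (fun p => fourierCoeff u.toL2 (aliasShift N m p)) (DFT (gridValues N u.toL2) (-m)) := by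
  have h1 : HasSum (fun l => 1 / (N : ℂ) ^ d * ∑ j : Fin d → Fin N,
      (fourierCoeff u.toL2 l * mFourier l (fun i => (((j i : ℕ) : ℝ) / (N : ℝ) : ℝ))) *
        Complex.exp (2 * Real.pi * Complex.I * ∑ i, ((j i : ℕ) : ℂ) / (N : ℂ) * ((-m) i : ℤ)))
      (DFT (gridValues N u.toL2) (-m)) :=
    (hasSum_sum fun j _ => (u.hasSum_pointValue hs _).mul_right _).mul_left _
  have h2 : ∀ l, 1 / (N : ℂ) ^ d * ∑ j : Fin d → Fin N,
      (fourierCoeff u.toL2 l * mFourier l (fun i => (((j i : ℕ) : ℝ) / (N : ℝ) : ℝ))) *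
        Complex.exp (2 * Real.pi * Complex.I * ∑ i, ((j i : ℕ) : ℂ) / (N : ℂ) * ((-m) i : ℤ)) =
      fourierCoeff u.toL2 l * if ∀ i, (N : ℤ) ∣ l i - m i then 1 else 0 := by
    intro l
    rw [← sum_grid_exp hN (fun i => l i - m i), mul_left_comm,
      Finset.mul_sum _ _ (fourierCoeff u.toL2 l)]
    congr 1
    refine Finset.sum_congr rfl fun j _ => ?_
    rw [mFourier_coe, mul_assoc, ← Complex.exp_add, ← mul_add, ← Finset.sum_add_distrib]
    congr 3
    refine Finset.sum_congr rfl fun i _ => ?_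
    push_cast [Pi.neg_apply]
    ring
  simp only [h2] at h1
  rw [← (aliasShift_injective hN m).hasSum_iff] at h1
  · convert! h1 using 2 with p
    simp [aliasShift]
  · intro l hl
    rw [if_neg, mul_zero]
    intro hdvd
    choose p hp using hdvd
    exact hl ⟨p, funext fun i => by simp only [aliasShift, ← hp]; ring⟩

theorem invSq_pos (p : ℤ) : 0 < invSq p := by
  unfold invSq
  split_ifs with h
  · exact one_pos
  · have : (p : ℝ) ≠ 0 := by exact_mod_cast h
    positivity

theorem Hs.norm_DFT_sub_sq_le {d s N K : ℕ} (hs : 1 ≤ s) (hN : 1 ≤ N) (hK : 2 * K < N)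
    (u : Hs d s) {m : Fin d → ℤ} (hm : m ∈ modes d K) :
    ‖DFT (gridValues N u.toL2) (-m) - fourierCoeff u.toL2 m‖ ^ 2 ≤
      ((Real.pi * N) ^ (2 * s))⁻¹ * 5 ^ d *
        ∑' p, weight s (aliasShift N m p) * ‖fourierCoeff u.toL2 (aliasShift N m p)‖ ^ 2 := by
  have hpi := Real.pi_pos
  have hN' : (0 : ℝ) < N := by exact_mod_cast hN
  set f : (Fin d → ℤ) → ℂ := fun p => fourierCoeff u.toL2 (aliasShift N m p) with hf
  set e : (Fin d → ℤ) → ℂ := fun p => f p - if p = 0 then fourierCoeff u.toL2 m else 0 with he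
  have hf0 : f 0 = fourierCoeff u.toL2 m := by
    simp only [hf]
    congr 1
    funext i
    simp [aliasShift]
  have hsum : HasSum e (DFT (gridValues N u.toL2) (-m) - fourierCoeff u.toL2 m) :=
    (u.hasSum_DFT hs hN m).sub (hasSum_ite_eq 0 _)
  set w : (Fin d → ℤ) → ℝ := fun p => (((Real.pi * N) ^ (2 * s))⁻¹ * ∏ i, invSq (p i))⁻¹ with hw
  have hprod : ∀ p : Fin d → ℤ, 0 < ((Real.pi * N) ^ (2 * s))⁻¹ * ∏ i, invSq (p i) := fun p =>
    mul_pos (by positivity) (Finset.prod_pos fun i _ => invSq_pos _)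
  have hwpos : ∀ p, 0 < w p := fun p => inv_pos.mpr (hprod p)
  have h1 : Summable fun p => (w p)⁻¹ := by
    simpa only [hw, inv_inv] using (summable_prod_invSq d).mul_left _
  have hle : ∀ p, w p * ‖e p‖ ^ 2 ≤ weight s (aliasShift N m p) * ‖f p‖ ^ 2 := by
    intro p
    by_cases hp : p = 0
    · subst hp
      have : e 0 = 0 := by simp [he, hf0]
      rw [this]
      simpa using mul_nonneg (weight_pos s _).le (sq_nonneg ‖f 0‖)
    · have : e p = f p := by simp [he, hp]
      rw [this]
      refine mul_le_mul_of_nonneg_right ?_ (sq_nonneg _)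
      exact inv_le_of_inv_le₀ (weight_pos s _) (inv_weight_aliasShift_le hs hN hK hm hp)
  have h2 : Summable fun p => weight s (aliasShift N m p) * ‖f p‖ ^ 2 :=
    u.summable_weight.comp_injective (aliasShift_injective hN m)
  have h3 : Summable fun p => w p * ‖e p‖ ^ 2 :=
    Summable.of_nonneg_of_le (fun p => mul_nonneg (hwpos p).le (sq_nonneg _)) hle h2
  obtain ⟨h4, h5⟩ := summable_norm_of_weighted hwpos h1 h3
  have h6 : ∑' p, (w p)⁻¹ ≤ ((Real.pi * N) ^ (2 * s))⁻¹ * 5 ^ d := by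
    simp only [hw, inv_inv, tsum_mul_left]
    gcongr
    exact tsum_prod_invSq_le d
  rw [← hsum.tsum_eq]
  calc ‖∑' p, e p‖ ^ 2 ≤ (∑' p, ‖e p‖) ^ 2 := by
        gcongr
        exact norm_tsum_le_tsum_norm h4
    _ ≤ _ := h5
    _ ≤ _ := mul_le_mul h6 (h3.tsum_le_tsum hle h2)
        (tsum_nonneg fun p => mul_nonneg (hwpos p).le (sq_nonneg _)) (by positivity)

theorem aliasShift_modes_injective {d N K : ℕ} (hK : 2 * K < N) :
    Function.Injective fun x : modes d K × (Fin d → ℤ) => aliasShift N x.1 x.2 := by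
  rintro ⟨m, p⟩ ⟨m', p'⟩ h
  have hmm : m = m' := by
    refine Subtype.ext (funext fun i => ?_)
    have h1 := abs_le.mp (mem_modes.mp m.2 i)
    have h2 := abs_le.mp (mem_modes.mp m'.2 i)
    have h3 : (m : Fin d → ℤ) i + N * p i = (m' : Fin d → ℤ) i + N * p' i := congrFun h i
    have h4 : (m : Fin d → ℤ) i - (m' : Fin d → ℤ) i = 0 := by
      refine Int.eq_zero_of_abs_lt_dvd (m := N) ⟨p' i - p i, by linarith⟩ ?_
      rw [abs_lt]
      constructor <;> omega
    omega
  subst hmm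
  rw [Prod.mk.injEq]
  exact ⟨rfl, aliasShift_injective (by omega) _ h⟩

theorem Hs.sum_norm_DFT_sub_sq_le {d s N K : ℕ} (hs : 1 ≤ s) (hK : 2 * K < N) (u : Hs d s) :
    ∑ m : modes d K, ‖DFT (gridValues N u.toL2) (-(m : Fin d → ℤ)) - fourierCoeff u.toL2 m‖ ^ 2 ≤
      ((Real.pi * N) ^ (2 * s))⁻¹ * 5 ^ d * u.sobolevNorm ^ 2 := by
  have hN : 1 ≤ N := by omega
  refine (Finset.sum_le_sum fun m _ => u.norm_DFT_sub_sq_le hs hN hK m.2).trans ?_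
  rw [← Finset.mul_sum]
  have hpi := Real.pi_pos
  gcongr
  have h1 : Summable fun x : modes d K × (Fin d → ℤ) =>
      weight s (aliasShift N x.1 x.2) * ‖fourierCoeff u.toL2 (aliasShift N x.1 x.2)‖ ^ 2 :=
    u.summable_weight.comp_injective (aliasShift_modes_injective hK)
  have h2 := h1.tsum_prod
  rw [tsum_fintype (L := _) (β := modes d K)] at h2
  rw [← h2, ← u.hasSum_weight.tsum_eq]
  exact tsum_comp_le_tsum_of_inj u.summable_weight
    (fun m => mul_nonneg (weight_pos s m).le (sq_nonneg _)) (aliasShift_modes_injective hK)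

/-! ### Bounds on the Fourier coefficients -/

theorem Hs.norm_fourierCoeff_sq_le {d s : ℕ} (u : Hs d s) (m : Fin d → ℤ) :
    ‖fourierCoeff u.toL2 m‖ ^ 2 ≤ u.sobolevNorm ^ 2 * (weight s m)⁻¹ := by
  rw [← div_eq_mul_inv, le_div_iff₀ (weight_pos s m), mul_comm]
  exact le_hasSum u.hasSum_weight m fun j _ => mul_nonneg (weight_pos s j).le (sq_nonneg _)

theorem Hs.sobolevNorm_nonneg {d s : ℕ} (u : Hs d s) : 0 ≤ u.sobolevNorm := Real.sqrt_nonneg _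

theorem Hs.norm_toL2_le {d s : ℕ} (u : Hs d s) : ‖u.toL2‖ ≤ u.sobolevNorm := by
  refine le_of_sq_le_sq ?_ u.sobolevNorm_nonneg
  refine hasSum_le (fun m => ?_) (hasSum_sq_fourierCoeff u.toL2) u.hasSum_weight
  exact le_mul_of_one_le_left (sq_nonneg _) (one_le_weight s m)

/-! ### Measurability -/

theorem fourierCoeff_eq_inner {d : ℕ} (u : L2R d) (m : Fin d → ℤ) :
    fourierCoeff u m = inner ℂ (mFourierLp 2 m) (toComplex u) := by
  rw [← mFourierCoeff_toComplex, ← mFourierBasis_repr, HilbertBasis.repr_apply_apply,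
    coe_mFourierBasis]

theorem continuous_fourierCoeff {d : ℕ} (m : Fin d → ℤ) :
    Continuous fun u : L2R d => fourierCoeff u m := by
  simp only [fourierCoeff_eq_inner]
  have : Continuous (toComplex (d := d)) :=
    (Complex.ofRealCLM.compLpL 2 (volume : Measure (UnitAddTorus (Fin d)))).continuous
  exact continuous_const.inner this

theorem Hs.measurable_fourierCoeff {d s : ℕ} (m : Fin d → ℤ) :
    Measurable fun u : Hs d s => fourierCoeff u.toL2 m := by
  let _ : MeasurableSpace (L2R d) := borel (L2R d)
  have : BorelSpace (L2R d) := ⟨rfl⟩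
  exact (continuous_fourierCoeff m).measurable.comp (comap_measurable Hs.toL2)

theorem Hs.measurable_fourierCoeff_fst {d s : ℕ} (m : Fin d → ℤ) :
    Measurable fun p : Hs d s × Hs d s => fourierCoeff p.1.toL2 m :=
  (Hs.measurable_fourierCoeff m).comp measurable_fst

theorem Hs.measurable_fourierCoeff_snd {d s : ℕ} (m : Fin d → ℤ) :
    Measurable fun p : Hs d s × Hs d s => fourierCoeff p.2.toL2 m :=
  (Hs.measurable_fourierCoeff m).comp measurable_snd

theorem measurable_of_hasSum {α ι E : Type*} [MeasurableSpace α] [Countable ι]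
    [NormedAddCommGroup E] [MeasurableSpace E] [BorelSpace E] [MeasurableAdd₂ E]
    {f : ι → α → E} {g : α → E} (hf : ∀ i, Measurable (f i))
    (h : ∀ a, HasSum (fun i => f i a) (g a)) : Measurable g := by
  refine measurable_of_tendsto_metrizable' (Filter.atTop : Filter (Finset ι))
    (f := fun F a => ∑ i ∈ F, f i a) (fun F => Finset.measurable_fun_sum F fun i _ => hf i) ?_
  rw [tendsto_pi_nhds]
  exact h

theorem Hs.measurable_pointValue {d s : ℕ} (hs : 1 ≤ s) (x : UnitAddTorus (Fin d)) :
    Measurable fun u : Hs d s => pointValue u.toL2 x := by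
  have h : Measurable fun u : Hs d s => (pointValue u.toL2 x : ℂ) :=
    measurable_of_hasSum (fun m => (Hs.measurable_fourierCoeff m).mul_const _)
      fun u => u.hasSum_pointValue hs x
  exact Complex.measurable_re.comp h

theorem measurable_gridData {d s n : ℕ} (hs : 1 ≤ s) (N : ℕ) :
    Measurable (gridData N : (Fin n → Hs d s × Hs d s) → _) := by
  have h : Measurable fun u : Hs d s => gridValues N u.toL2 :=
    measurable_pi_lambda _ fun j => Hs.measurable_pointValue hs _
  refine measurable_pi_lambda _ fun i => ?_
  exact (h.comp (measurable_fst.comp (measurable_pi_apply i))).prodMk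
    (h.comp (measurable_snd.comp (measurable_pi_apply i)))

/-! ### Fourier multipliers -/

theorem mFourierCoeff_multiplier {d : ℕ} {C : ℝ} {lam : (Fin d → ℤ) → ℂ} (hlam : ∀ m, ‖lam m‖ ≤ C)
    (v : L2R d) (m : Fin d → ℤ) :
    mFourierCoeff (multiplier lam v) m = lam m * fourierCoeff v m := by
  have hmem : Memℓp (fun m => lam m * fourierCoeff v m) 2 := by
    refine memℓp_gen ?_
    have h := (hasSum_sq_fourierCoeff v).summable.mul_left (C ^ 2)
    refine Summable.of_nonneg_of_le (fun m => by positivity) (fun m => ?_) h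
    rw [ENNReal.toReal_ofNat, Real.rpow_ofNat, norm_mul, mul_pow]
    gcongr
    exact hlam m
  have h := (mFourierBasis (d := Fin d)).hasSum_repr_symm ⟨_, hmem⟩
  rw [coe_mFourierBasis] at h
  have h2 : multiplier lam v = mFourierBasis.repr.symm ⟨_, hmem⟩ := h.tsum_eq
  rw [← mFourierBasis_repr, h2, LinearIsometryEquiv.apply_symm_apply]

theorem hasSum_loss {d s : ℕ} {C : ℝ} {lam : (Fin d → ℤ) → ℂ} (hlam : ∀ m, ‖lam m‖ ≤ C)
    (p : Hs d s × Hs d s) :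
    HasSum (fun m => ‖lam m * fourierCoeff p.1.toL2 m - fourierCoeff p.2.toL2 m‖ ^ 2)
      (loss (multiplier lam) p) := by
  convert! hasSum_sq_of_L2 (multiplier lam p.1.toL2 - toComplex p.2.toL2) using 4 with m
  rw [← mFourierBasis_repr, map_sub, lp.coeFn_sub, Pi.sub_apply, mFourierBasis_repr,
    mFourierBasis_repr, mFourierCoeff_multiplier hlam, mFourierCoeff_toComplex]

theorem measurable_loss {d s : ℕ} {C : ℝ} {lam : (Fin d → ℤ) → ℂ} (hlam : ∀ m, ‖lam m‖ ≤ C) :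
    Measurable (loss (multiplier lam) : Hs d s × Hs d s → ℝ) :=
  measurable_of_hasSum (fun m => (((Hs.measurable_fourierCoeff_fst m).const_mul (lam m)).sub
    (Hs.measurable_fourierCoeff_snd m)).norm.pow_const 2) (hasSum_loss hlam)

theorem norm_multiplier_le {d : ℕ} {C : ℝ} (hC : 0 ≤ C) {lam : (Fin d → ℤ) → ℂ}
    (hlam : ∀ m, ‖lam m‖ ≤ C) (v : L2R d) : ‖multiplier lam v‖ ≤ C * ‖v‖ := by
  refine le_of_sq_le_sq ?_ (by positivity)
  rw [mul_pow]
  refine hasSum_le (fun m => ?_) (hasSum_sq_of_L2 (multiplier lam v))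
    ((hasSum_sq_fourierCoeff v).mul_left (C ^ 2))
  rw [mFourierCoeff_multiplier hlam, norm_mul, mul_pow]
  gcongr
  exact hlam m

theorem loss_nonneg {d s : ℕ} (T : L2R d → L2C d) (p : Hs d s × Hs d s) : 0 ≤ loss T p :=
  sq_nonneg _

theorem loss_le {d s : ℕ} {B C : ℝ} (hC : 0 ≤ C) {lam : (Fin d → ℤ) → ℂ}
    (hlam : ∀ m, ‖lam m‖ ≤ C) {p : Hs d s × Hs d s} (hp : p.1.sobolevNorm ≤ B ∧ p.2.sobolevNorm ≤ B) :
    loss (multiplier lam) p ≤ ((C + 1) * B) ^ 2 := by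
  have h1 := p.1.norm_toL2_le.trans hp.1
  have h2 := p.2.norm_toL2_le.trans hp.2
  have h3 := norm_multiplier_le hC hlam p.1.toL2
  refine pow_le_pow_left₀ (norm_nonneg _) ((norm_sub_le _ _).trans ?_) 2
  rw [norm_toComplex]
  nlinarith [mul_le_mul_of_nonneg_left h1 hC]

theorem integrable_loss {d s : ℕ} {B C : ℝ} (hC : 0 ≤ C) {lam : (Fin d → ℤ) → ℂ}
    (hlam : ∀ m, ‖lam m‖ ≤ C) {μ : Measure (Hs d s × Hs d s)} [IsFiniteMeasure μ]
    (hμ : ∀ᵐ p ∂μ, p.1.sobolevNorm ≤ B ∧ p.2.sobolevNorm ≤ B) :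
    Integrable (loss (multiplier lam)) μ := by
  refine Integrable.of_bound (measurable_loss hlam).aestronglyMeasurable (((C + 1) * B) ^ 2) ?_
  filter_upwards [hμ] with p hp
  rw [Real.norm_of_nonneg (loss_nonneg _ _)]
  exact loss_le hC hlam hp

open Classical in
/-- The extension by zero of a sequence of low-mode coefficients. -/
noncomputable def extendZero {d K : ℕ} (lam : modes d K → ℂ) (m : Fin d → ℤ) : ℂ :=
  if h : m ∈ modes d K then lam ⟨m, h⟩ else 0

theorem extendZero_coe {d K : ℕ} (lam : modes d K → ℂ) (m : modes d K) :
    extendZero lam m = lam m := dif_pos m.2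

theorem extendZero_of_notMem {d K : ℕ} (lam : modes d K → ℂ) {m : Fin d → ℤ} (h : m ∉ modes d K) :
    extendZero lam m = 0 := dif_neg h

theorem norm_extendZero_le {d K : ℕ} {C : ℝ} (hC : 0 ≤ C) {lam : modes d K → ℂ}
    (h : ∀ m, ‖lam m‖ ≤ C) (m : Fin d → ℤ) : ‖extendZero lam m‖ ≤ C := by
  unfold extendZero
  split_ifs
  · exact h _
  · simpa using hC

theorem truncatedMultiplier_eq {d K : ℕ} (lam : modes d K → ℂ) :
    truncatedMultiplier lam = multiplier (extendZero lam) := by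
  funext v
  unfold truncatedMultiplier multiplier
  rw [tsum_eq_sum (s := modes d K) fun m hm => by rw [extendZero_of_notMem lam hm]; simp]
  refine Eq.trans (Finset.sum_congr rfl fun m _ => ?_) (Finset.sum_coe_sort (modes d K)
    fun m => (extendZero lam m * fourierCoeff v m) • mFourierLp 2 m)
  rw [extendZero_coe]

/-! ### Deviation of empirical means -/

theorem integral_linearCombination {Ω : Type*} [MeasurableSpace Ω] {ν : Measure Ω} {f g h : Ω → ℝ}
    (hf : Integrable f ν) (hg : Integrable g ν) (hh : Integrable h ν) (a b c : ℝ) :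
    Integrable (fun x => a * f x + b * g x + c * h x) ν ∧
      ∫ x, (a * f x + b * g x + c * h x) ∂ν =
        a * ∫ x, f x ∂ν + b * ∫ x, g x ∂ν + c * ∫ x, h x ∂ν := by
  have hab : Integrable (fun x => a * f x + b * g x) ν := (hf.const_mul a).add (hg.const_mul b)
  refine ⟨hab.add (hh.const_mul c), ?_⟩
  rw [integral_add hab (hh.const_mul c), integral_add (hf.const_mul a) (hg.const_mul b),
    integral_const_mul, integral_const_mul, integral_const_mul]


/-- The absolute deviation of the empirical mean of `f` from its expectation. -/
noncomputable def meanDeviation {Ω : Type*} [MeasurableSpace Ω] {n : ℕ} (μ : Measure Ω) (f : Ω → ℝ)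
    (S : Fin n → Ω) : ℝ :=
  |1 / (n : ℝ) * ∑ i, f (S i) - ∫ x, f x ∂μ|

theorem meanDeviation_integral_le {Ω : Type*} [MeasurableSpace Ω] {n : ℕ} (hn : 1 ≤ n)
    (μ : Measure Ω) [IsProbabilityMeasure μ] {f : Ω → ℝ} (hf : Measurable f) {M : ℝ}
    (hM : ∀ᵐ x ∂μ, |f x| ≤ M) :
    Integrable (meanDeviation μ f) (Measure.pi fun _ : Fin n => μ) ∧
      ∫ S, meanDeviation μ f S ∂(Measure.pi fun _ : Fin n => μ) ≤ M / Real.sqrt n := by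
  have hn0 : (0 : ℝ) < n := by exact_mod_cast hn
  have hM0 : 0 ≤ M := by
    obtain ⟨x, hx⟩ := hM.exists
    exact (abs_nonneg _).trans hx
  set P := Measure.pi fun _ : Fin n => μ with hP
  have hf2 : MemLp f 2 μ := MemLp.of_bound hf.aestronglyMeasurable M hM
  have hfi : ∀ i : Fin n, MemLp (fun S : Fin n → Ω => f (S i)) 2 P := fun i =>
    hf2.comp_measurePreserving (measurePreserving_eval _ i)
  have hint : ∀ i : Fin n, ∫ S : Fin n → Ω, f (S i) ∂P = ∫ x, f x ∂μ := fun i =>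
    integral_comp_eval hf.aestronglyMeasurable
  set Y : (Fin n → Ω) → ℝ := ∑ i, fun S => f (S i) with hY
  have hYm : MemLp Y 2 P := memLp_finsetSum' _ fun i _ => hfi i
  have hEY : ∫ S, Y S ∂P = n * ∫ x, f x ∂μ := by
    simp only [hY, Finset.sum_apply]
    rw [integral_finsetSum _ fun i _ => (hfi i).integrable (by norm_num)]
    simp [hint]
  have hdev : ∀ S, meanDeviation μ f S = 1 / (n : ℝ) * |Y S - ∫ S, Y S ∂P| := by
    intro S
    have h1 : 1 / (n : ℝ) * ∑ i, f (S i) - ∫ x, f x ∂μ = 1 / (n : ℝ) * (Y S - ∫ S, Y S ∂P) := by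
      rw [hEY]
      simp only [hY, Finset.sum_apply]
      field_simp
    rw [meanDeviation, h1, abs_mul, abs_of_pos (one_div_pos.mpr hn0)]
  have hZ : MemLp (fun S => |Y S - ∫ S, Y S ∂P|) 2 P := (hYm.sub (memLp_const _)).norm
  have hvar : ∫ S, (Y S - ∫ S, Y S ∂P) ^ 2 ∂P ≤ n * M ^ 2 := by
    rw [← ProbabilityTheory.variance_eq_integral hYm.aestronglyMeasurable.aemeasurable, hY, hP,
      ProbabilityTheory.variance_sum_pi fun _ => hf2]
    have h1 : ProbabilityTheory.variance f μ ≤ M ^ 2 := by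
      refine (ProbabilityTheory.variance_le_expectation_sq hf.aestronglyMeasurable).trans ?_
      calc ∫ x, (f ^ 2) x ∂μ ≤ ∫ _, M ^ 2 ∂μ := by
            refine integral_mono_ae hf2.integrable_sq (integrable_const _) ?_
            filter_upwards [hM] with x hx
            exact sq_le_sq' (abs_le.mp hx).1 (abs_le.mp hx).2
        _ = M ^ 2 := by simp
    simpa using mul_le_mul_of_nonneg_left h1 hn0.le
  have hsq : (∫ S, |Y S - ∫ S, Y S ∂P| ∂P) ^ 2 ≤ n * M ^ 2 := by
    have h1 := ProbabilityTheory.variance_nonneg (fun S => |Y S - ∫ S, Y S ∂P|) P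
    rw [ProbabilityTheory.variance_eq_sub hZ] at h1
    simp only [Pi.pow_apply, sq_abs] at h1
    linarith
  have hle : ∫ S, |Y S - ∫ S, Y S ∂P| ∂P ≤ Real.sqrt n * M := by
    refine le_of_sq_le_sq ?_ (by positivity)
    rwa [mul_pow, Real.sq_sqrt hn0.le]
  refine ⟨?_, ?_⟩
  · rw [funext hdev]
    exact (hZ.integrable (by norm_num)).const_mul _
  · simp only [hdev]
    rw [integral_const_mul, le_div_iff₀ (Real.sqrt_pos.mpr hn0)]
    calc 1 / (n : ℝ) * (∫ S, |Y S - ∫ S, Y S ∂P| ∂P) * Real.sqrt n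
        ≤ 1 / (n : ℝ) * (Real.sqrt n * M) * Real.sqrt n := by gcongr
      _ = 1 / (n : ℝ) * (Real.sqrt n * Real.sqrt n) * M := by ring
      _ = M := by rw [Real.mul_self_sqrt hn0.le]; field_simp

/-! ### The low-mode part of the loss -/

/-- The part of the loss that is carried by the low modes. -/
noncomputable def lowLoss {d s K : ℕ} (lam : modes d K → ℂ) (p : Hs d s × Hs d s) : ℝ :=
  ∑ m : modes d K, ‖lam m * fourierCoeff p.1.toL2 m - fourierCoeff p.2.toL2 m‖ ^ 2

/-- The squared modulus of a Fourier coefficient of the input. -/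
noncomputable def inputPower {d s : ℕ} (m : Fin d → ℤ) (p : Hs d s × Hs d s) : ℝ :=
  ‖fourierCoeff p.1.toL2 m‖ ^ 2

/-- The product of a Fourier coefficient of the input with the conjugate one of the output. -/
noncomputable def crossPower {d s : ℕ} (m : Fin d → ℤ) (p : Hs d s × Hs d s) : ℂ :=
  fourierCoeff p.1.toL2 m * (starRingEnd ℂ) (fourierCoeff p.2.toL2 m)

theorem measurable_inputPower {d s : ℕ} (m : Fin d → ℤ) :
    Measurable (inputPower m : Hs d s × Hs d s → ℝ) :=
  (Hs.measurable_fourierCoeff_fst m).norm.pow_const 2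

theorem measurable_crossPower {d s : ℕ} (m : Fin d → ℤ) :
    Measurable (crossPower m : Hs d s × Hs d s → ℂ) :=
  (Hs.measurable_fourierCoeff_fst m).mul
    (Complex.continuous_conj.measurable.comp (Hs.measurable_fourierCoeff_snd m))

theorem norm_fourierCoeff_sq_le_of_le {d s : ℕ} {B : ℝ} {u : Hs d s} (hu : u.sobolevNorm ≤ B)
    (m : Fin d → ℤ) : ‖fourierCoeff u.toL2 m‖ ^ 2 ≤ B ^ 2 * (weight s m)⁻¹ := by
  refine (u.norm_fourierCoeff_sq_le m).trans ?_
  have := u.sobolevNorm_nonneg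
  have := weight_pos s m
  gcongr

theorem inputPower_le {d s : ℕ} {B : ℝ} {p : Hs d s × Hs d s}
    (hp : p.1.sobolevNorm ≤ B ∧ p.2.sobolevNorm ≤ B) (m : Fin d → ℤ) :
    |inputPower m p| ≤ B ^ 2 * (weight s m)⁻¹ := by
  rw [abs_of_nonneg (sq_nonneg _)]
  exact norm_fourierCoeff_sq_le_of_le hp.1 m

theorem norm_crossPower_le {d s : ℕ} {B : ℝ} {p : Hs d s × Hs d s}
    (hp : p.1.sobolevNorm ≤ B ∧ p.2.sobolevNorm ≤ B) (m : Fin d → ℤ) :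
    ‖crossPower m p‖ ≤ B ^ 2 * (weight s m)⁻¹ := by
  have h1 := norm_fourierCoeff_sq_le_of_le hp.1 m
  have h2 := norm_fourierCoeff_sq_le_of_le hp.2 m
  rw [crossPower, norm_mul, RCLike.norm_conj]
  nlinarith [sq_nonneg (‖fourierCoeff p.1.toL2 m‖ - ‖fourierCoeff p.2.toL2 m‖)]

theorem norm_mul_sub_sq (l a b : ℂ) :
    ‖l * a - b‖ ^ 2 = ‖l‖ ^ 2 * ‖a‖ ^ 2 - 2 * l.re * (a * (starRingEnd ℂ) b).re
      + 2 * l.im * (a * (starRingEnd ℂ) b).im + ‖b‖ ^ 2 := by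
  simp only [← Complex.normSq_eq_norm_sq, Complex.normSq_apply, Complex.sub_re, Complex.sub_im,
    Complex.mul_re, Complex.mul_im, Complex.conj_re, Complex.conj_im]
  ring

theorem lowLoss_sub {d s K : ℕ} (lam lam' : modes d K → ℂ) (p : Hs d s × Hs d s) :
    lowLoss lam p - lowLoss lam' p = ∑ m : modes d K,
      ((‖lam m‖ ^ 2 - ‖lam' m‖ ^ 2) * inputPower m p
        + 2 * (lam' m - lam m).re * (crossPower m p).re
        + 2 * (lam m - lam' m).im * (crossPower m p).im) := by
  unfold lowLoss
  rw [← Finset.sum_sub_distrib]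
  refine Finset.sum_congr rfl fun m _ => ?_
  simp only [norm_mul_sub_sq, inputPower, crossPower, Complex.sub_re, Complex.sub_im]
  ring

/-- A bound for the uniform deviation of the empirical low-mode risk differences. -/
noncomputable def uniformDeviation {d s n : ℕ} (K : ℕ) (C : ℝ) (μ : Measure (Hs d s × Hs d s))
    (S : Fin n → Hs d s × Hs d s) : ℝ :=
  ∑ m : modes d K, (C ^ 2 * meanDeviation μ (inputPower m) S
    + 4 * C * meanDeviation μ (fun p => (crossPower m p).re) S
    + 4 * C * meanDeviation μ (fun p => (crossPower m p).im) S)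

theorem ae_abs_inputPower_le {d s : ℕ} {B : ℝ} {μ : Measure (Hs d s × Hs d s)}
    (hμ : ∀ᵐ p ∂μ, p.1.sobolevNorm ≤ B ∧ p.2.sobolevNorm ≤ B) (m : Fin d → ℤ) :
    ∀ᵐ p ∂μ, |inputPower m p| ≤ B ^ 2 * (weight s m)⁻¹ := by
  filter_upwards [hμ] with p hp using inputPower_le hp m

theorem ae_abs_re_crossPower_le {d s : ℕ} {B : ℝ} {μ : Measure (Hs d s × Hs d s)}
    (hμ : ∀ᵐ p ∂μ, p.1.sobolevNorm ≤ B ∧ p.2.sobolevNorm ≤ B) (m : Fin d → ℤ) :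
    ∀ᵐ p ∂μ, |(crossPower m p).re| ≤ B ^ 2 * (weight s m)⁻¹ := by
  filter_upwards [hμ] with p hp using (Complex.abs_re_le_norm _).trans (norm_crossPower_le hp m)

theorem ae_abs_im_crossPower_le {d s : ℕ} {B : ℝ} {μ : Measure (Hs d s × Hs d s)}
    (hμ : ∀ᵐ p ∂μ, p.1.sobolevNorm ≤ B ∧ p.2.sobolevNorm ≤ B) (m : Fin d → ℤ) :
    ∀ᵐ p ∂μ, |(crossPower m p).im| ≤ B ^ 2 * (weight s m)⁻¹ := by
  filter_upwards [hμ] with p hp using (Complex.abs_im_le_norm _).trans (norm_crossPower_le hp m)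

theorem measurable_re_crossPower {d s : ℕ} (m : Fin d → ℤ) :
    Measurable fun p : Hs d s × Hs d s => (crossPower m p).re :=
  Complex.measurable_re.comp (measurable_crossPower m)

theorem measurable_im_crossPower {d s : ℕ} (m : Fin d → ℤ) :
    Measurable fun p : Hs d s × Hs d s => (crossPower m p).im :=
  Complex.measurable_im.comp (measurable_crossPower m)

theorem uniformDeviation_integral_le {d s n K : ℕ} (hs : 1 ≤ s) (hds : d ≤ 2 * s) (hn : 1 ≤ n)
    {B C : ℝ} (hC : 0 ≤ C) {μ : Measure (Hs d s × Hs d s)} [IsProbabilityMeasure μ]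
    (hμ : ∀ᵐ p ∂μ, p.1.sobolevNorm ≤ B ∧ p.2.sobolevNorm ≤ B) :
    Integrable (uniformDeviation K C μ) (Measure.pi fun _ : Fin n => μ) ∧
      ∫ S, uniformDeviation K C μ S ∂(Measure.pi fun _ : Fin n => μ) ≤
        8 * B ^ 2 * (C + 1) ^ 2 * (1 / Real.sqrt n) := by
  have hA := fun m : Fin d → ℤ =>
    meanDeviation_integral_le hn μ (measurable_inputPower m) (ae_abs_inputPower_le hμ m)
  have hR := fun m : Fin d → ℤ =>
    meanDeviation_integral_le hn μ (measurable_re_crossPower m) (ae_abs_re_crossPower_le hμ m)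
  have hI := fun m : Fin d → ℤ =>
    meanDeviation_integral_le hn μ (measurable_im_crossPower m) (ae_abs_im_crossPower_le hμ m)
  have hint := fun m : modes d K => integral_linearCombination (hA m).1 (hR m).1 (hI m).1
    (C ^ 2) (4 * C) (4 * C)
  refine ⟨integrable_finsetSum _ fun m _ => (hint m).1, ?_⟩
  unfold uniformDeviation
  rw [integral_finsetSum _ fun m _ => (hint m).1]
  have hn0 : (0 : ℝ) < Real.sqrt n := Real.sqrt_pos.mpr (by exact_mod_cast hn)
  calc _ ≤ ∑ m : modes d K, (C ^ 2 + 8 * C) * (B ^ 2 / Real.sqrt n) *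
        (weight s (m : Fin d → ℤ))⁻¹ := by
        refine Finset.sum_le_sum fun m _ => ?_
        rw [(hint m).2]
        have h1 := mul_le_mul_of_nonneg_left (hA m).2 (sq_nonneg C)
        have h2 := mul_le_mul_of_nonneg_left (hR m).2 (by positivity : 0 ≤ 4 * C)
        have h3 := mul_le_mul_of_nonneg_left (hI m).2 (by positivity : 0 ≤ 4 * C)
        refine (add_le_add (add_le_add h1 h2) h3).trans (le_of_eq ?_)
        ring
    _ = (C ^ 2 + 8 * C) * (B ^ 2 / Real.sqrt n) * ∑ m : modes d K,
        (weight s (m : Fin d → ℤ))⁻¹ := by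
        rw [Finset.mul_sum]
    _ ≤ (C ^ 2 + 8 * C) * (B ^ 2 / Real.sqrt n) * 2 := by
        gcongr
        rw [Finset.sum_coe_sort (modes d K) fun m => (weight s m)⁻¹]
        exact ((summable_inv_weight hs).sum_le_tsum _
          fun m _ => (inv_pos.mpr (weight_pos s m)).le).trans (tsum_inv_weight_le hs hds)
    _ ≤ 8 * B ^ 2 * (C + 1) ^ 2 * (1 / Real.sqrt n) := by
        have h : (C ^ 2 + 8 * C) * 2 ≤ 8 * (C + 1) ^ 2 := by nlinarith [sq_nonneg C]
        have := mul_le_mul_of_nonneg_right h (by positivity : 0 ≤ B ^ 2 / Real.sqrt n)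
        refine (le_of_eq ?_).trans (this.trans (le_of_eq ?_)) <;> ring

theorem lowLoss_deviation_le {d s n K : ℕ} {B C : ℝ} {μ : Measure (Hs d s × Hs d s)}
    [IsProbabilityMeasure μ] (hμ : ∀ᵐ p ∂μ, p.1.sobolevNorm ≤ B ∧ p.2.sobolevNorm ≤ B)
    {lam lam' : modes d K → ℂ} (h : ∀ m, ‖lam m‖ ≤ C) (h' : ∀ m, ‖lam' m‖ ≤ C)
    (S : Fin n → Hs d s × Hs d s) :
    ∫ p, (lowLoss lam p - lowLoss lam' p) ∂μ ≤
      1 / (n : ℝ) * ∑ i, (lowLoss lam (S i) - lowLoss lam' (S i)) + uniformDeviation K C μ S := by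
  have hA := fun m : Fin d → ℤ => Integrable.of_bound (μ := μ)
    (measurable_inputPower m).aestronglyMeasurable _ (ae_abs_inputPower_le hμ m)
  have hR := fun m : Fin d → ℤ => Integrable.of_bound (μ := μ)
    (measurable_re_crossPower m).aestronglyMeasurable _ (ae_abs_re_crossPower_le hμ m)
  have hI := fun m : Fin d → ℤ => Integrable.of_bound (μ := μ)
    (measurable_im_crossPower m).aestronglyMeasurable _ (ae_abs_im_crossPower_le hμ m)
  simp only [lowLoss_sub]
  have hint := fun m : modes d K => integral_linearCombination (hA m) (hR m) (hI m)
  rw [integral_finsetSum _ fun m _ => (hint m _ _ _).1, Finset.sum_comm, Finset.mul_sum,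
    uniformDeviation, ← Finset.sum_add_distrib]
  refine Finset.sum_le_sum fun m _ => ?_
  rw [(hint m _ _ _).2]
  simp only [Finset.sum_add_distrib, ← Finset.mul_sum]
  have key : ∀ (c c' : ℝ) (f : Hs d s × Hs d s → ℝ), |c| ≤ c' →
      c * ∫ p, f p ∂μ ≤ 1 / (n : ℝ) * (c * ∑ i, f (S i)) + c' * meanDeviation μ f S := by
    intro c c' f hc
    have h1 : -(c * (1 / (n : ℝ) * ∑ i, f (S i) - ∫ x, f x ∂μ)) ≤ c' * meanDeviation μ f S := by
      refine (neg_le_abs _).trans ?_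
      rw [abs_mul]
      exact mul_le_mul_of_nonneg_right hc (abs_nonneg _)
    linarith
  have hl := h m
  have hl' := h' m
  have hn : 0 ≤ ‖lam m‖ := norm_nonneg _
  have hn' : 0 ≤ ‖lam' m‖ := norm_nonneg _
  have k1 := key (‖lam m‖ ^ 2 - ‖lam' m‖ ^ 2) (C ^ 2) (inputPower m) (by
    rw [abs_le]
    constructor <;> nlinarith)
  have k2 := key (2 * (lam' m - lam m).re) (4 * C) (fun p => (crossPower m p).re) (by
    rw [abs_mul, abs_two]
    linarith [Complex.abs_re_le_norm (lam' m - lam m), norm_sub_le (lam' m) (lam m)])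
  have k3 := key (2 * (lam m - lam' m).im) (4 * C) (fun p => (crossPower m p).im) (by
    rw [abs_mul, abs_two]
    linarith [Complex.abs_im_le_norm (lam m - lam' m), norm_sub_le (lam m) (lam' m)])
  linarith

/-! ### Discretization and truncation errors -/

theorem abs_sum_norm_sq_sub_le {ι : Type*} [Fintype ι] {x y : ι → ℂ} {X E : ℝ} (hX : 0 ≤ X)
    (hE : 0 ≤ E) (hx : ∑ i, ‖x i‖ ^ 2 ≤ X ^ 2) (hy : ∑ i, ‖y i - x i‖ ^ 2 ≤ E ^ 2) :
    |∑ i, ‖y i‖ ^ 2 - ∑ i, ‖x i‖ ^ 2| ≤ E * (2 * X + E) := by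
  have h1 : ∑ i, ‖x i‖ * ‖y i - x i‖ ≤ X * E := by
    refine (Real.sum_mul_le_sqrt_mul_sqrt _ _ _).trans ?_
    exact mul_le_mul (Real.sqrt_le_iff.mpr ⟨hX, hx⟩) (Real.sqrt_le_iff.mpr ⟨hE, hy⟩)
      (Real.sqrt_nonneg _) hX
  rw [← Finset.sum_sub_distrib]
  calc |∑ i, (‖y i‖ ^ 2 - ‖x i‖ ^ 2)| ≤ ∑ i, |‖y i‖ ^ 2 - ‖x i‖ ^ 2| :=
        Finset.abs_sum_le_sum_abs _ _
    _ ≤ ∑ i, (2 * (‖x i‖ * ‖y i - x i‖) + ‖y i - x i‖ ^ 2) := by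
        refine Finset.sum_le_sum fun i _ => ?_
        have h2 := norm_nonneg (x i)
        have h3 := norm_nonneg (y i)
        have h4 : |‖y i‖ - ‖x i‖| ≤ ‖y i - x i‖ := abs_norm_sub_norm_le _ _
        rw [sq_sub_sq, abs_mul, abs_of_nonneg (add_nonneg h3 h2)]
        have h5 : ‖y i‖ + ‖x i‖ ≤ 2 * ‖x i‖ + ‖y i - x i‖ := by linarith [le_abs_self (‖y i‖ - ‖x i‖)]
        refine (mul_le_mul h5 h4 (abs_nonneg _) (by positivity)).trans (le_of_eq ?_)
        ring
    _ = 2 * ∑ i, ‖x i‖ * ‖y i - x i‖ + ∑ i, ‖y i - x i‖ ^ 2 := by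
        rw [Finset.sum_add_distrib, Finset.mul_sum]
    _ ≤ E * (2 * X + E) := by nlinarith

theorem sum_norm_mul_sub_sq_le {ι : Type*} [Fintype ι] {a b l : ι → ℂ} {C Y : ℝ} (hC : 0 ≤ C)
    (hl : ∀ i, ‖l i‖ ≤ C) (ha : ∑ i, ‖a i‖ ^ 2 ≤ Y) (hb : ∑ i, ‖b i‖ ^ 2 ≤ Y) :
    ∑ i, ‖l i * a i - b i‖ ^ 2 ≤ (C + 1) ^ 2 * Y := by
  calc ∑ i, ‖l i * a i - b i‖ ^ 2
      ≤ ∑ i, ((C ^ 2 + C) * ‖a i‖ ^ 2 + (C + 1) * ‖b i‖ ^ 2) := by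
        refine Finset.sum_le_sum fun i _ => ?_
        have h1 : ‖l i * a i - b i‖ ≤ C * ‖a i‖ + ‖b i‖ := by
          refine (norm_sub_le _ _).trans ?_
          rw [norm_mul]
          gcongr
          exact hl i
        refine (pow_le_pow_left₀ (norm_nonneg _) h1 2).trans ?_
        nlinarith [mul_nonneg hC (sq_nonneg (‖a i‖ - ‖b i‖))]
    _ = (C ^ 2 + C) * ∑ i, ‖a i‖ ^ 2 + (C + 1) * ∑ i, ‖b i‖ ^ 2 := by
        rw [Finset.sum_add_distrib, Finset.mul_sum, Finset.mul_sum]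
    _ ≤ (C ^ 2 + C) * Y + (C + 1) * Y := by gcongr
    _ = (C + 1) ^ 2 * Y := by ring

theorem Hs.sum_norm_fourierCoeff_sq_le {d s K : ℕ} {B : ℝ} {u : Hs d s} (hu : u.sobolevNorm ≤ B) :
    ∑ m : modes d K, ‖fourierCoeff u.toL2 m‖ ^ 2 ≤ B ^ 2 := by
  rw [Finset.sum_coe_sort (modes d K) fun m => ‖fourierCoeff u.toL2 m‖ ^ 2]
  refine (sum_le_hasSum _ (fun m _ => sq_nonneg _) (hasSum_sq_fourierCoeff u.toL2)).trans ?_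
  exact pow_le_pow_left₀ (norm_nonneg _) (u.norm_toL2_le.trans hu) 2

/-- The relative size of the aliasing error of the discrete Fourier transform. -/
noncomputable def aliasError (d s N : ℕ) : ℝ := Real.sqrt (5 ^ d) / (Real.pi * N) ^ s

theorem aliasError_nonneg (d s N : ℕ) : 0 ≤ aliasError d s N := by
  have := Real.pi_pos
  unfold aliasError
  positivity

theorem aliasError_sq (d s N : ℕ) :
    aliasError d s N ^ 2 = ((Real.pi * N) ^ (2 * s))⁻¹ * 5 ^ d := by
  rw [aliasError, div_pow, Real.sq_sqrt (by positivity), ← pow_mul, mul_comm s 2,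
    div_eq_inv_mul]

theorem aliasError_le_one {d s N : ℕ} (hds : d ≤ 2 * s) (hN : 5 ≤ N) : aliasError d s N ≤ 1 := by
  have hN' : (5 : ℝ) ≤ N := by exact_mod_cast hN
  have hpi := Real.pi_gt_three
  refine le_of_sq_le_sq ?_ zero_le_one
  rw [aliasError_sq, inv_mul_le_iff₀ (by positivity), one_pow, mul_one]
  refine (pow_le_pow_right₀ (by norm_num) hds).trans (pow_le_pow_left₀ (by norm_num) ?_ _)
  nlinarith

theorem aliasError_le {d s N : ℕ} (hds : d ≤ 2 * s) :
    aliasError d s N ≤ 2 ^ s * Real.sqrt (Real.pi ^ d) / (N : ℝ) ^ s := by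
  have hpi := Real.pi_gt_three
  have h1 : Real.sqrt (5 ^ d) ≤ Real.pi ^ s * Real.sqrt (Real.pi ^ d) := by
    refine Real.sqrt_le_iff.mpr ⟨by positivity, ?_⟩
    rw [mul_pow, Real.sq_sqrt (by positivity), ← pow_mul, mul_comm s 2]
    calc (5 : ℝ) ^ d ≤ (Real.pi * Real.pi) ^ d := pow_le_pow_left₀ (by norm_num) (by nlinarith) _
      _ = Real.pi ^ d * Real.pi ^ d := mul_pow _ _ _
      _ ≤ Real.pi ^ (2 * s) * Real.pi ^ d := by
        gcongr
        linarith
  have h2 : (1 : ℝ) ≤ 2 ^ s := one_le_pow₀ (by norm_num)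
  calc aliasError d s N ≤ Real.pi ^ s * Real.sqrt (Real.pi ^ d) / (Real.pi * N) ^ s := by
        unfold aliasError
        gcongr
    _ = 1 * Real.sqrt (Real.pi ^ d) / (N : ℝ) ^ s := by
        rw [mul_pow, mul_div_mul_left _ _ (by positivity), one_mul]
    _ ≤ _ := by gcongr

theorem abs_objective_sub_le {d s n N K : ℕ} (hs : 1 ≤ s) (hds : d ≤ 2 * s) (hn : 1 ≤ n)
    (hN : 5 ≤ N) (hK : 2 * K < N) {B C : ℝ} (hB : 0 ≤ B) (hC : 0 ≤ C)
    {S : Fin n → Hs d s × Hs d s} (hS : ∀ i, (S i).1.sobolevNorm ≤ B ∧ (S i).2.sobolevNorm ≤ B)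
    {lam : modes d K → ℂ} (hlam : ∀ m, ‖lam m‖ ≤ C) :
    |objective (gridData N S) lam - 1 / (n : ℝ) * ∑ i, lowLoss lam (S i)| ≤
      3 * B ^ 2 * (C + 1) ^ 2 * aliasError d s N := by
  have hη := aliasError_nonneg d s N
  have hη1 := aliasError_le_one hds hN
  have hn0 : (0 : ℝ) < n := by exact_mod_cast hn
  have halias : ∀ u : Hs d s, u.sobolevNorm ≤ B → ∑ m : modes d K,
      ‖DFT (gridValues N u.toL2) (-(m : Fin d → ℤ)) - fourierCoeff u.toL2 m‖ ^ 2 ≤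
      (aliasError d s N * B) ^ 2 := by
    intro u hu
    refine (u.sum_norm_DFT_sub_sq_le hs hK).trans ?_
    rw [← aliasError_sq, mul_pow]
    have := u.sobolevNorm_nonneg
    gcongr
  have key : ∀ i, |∑ m : modes d K, ‖lam m * DFT (gridData N S i).1 (-(m : Fin d → ℤ)) -
      DFT (gridData N S i).2 (-(m : Fin d → ℤ))‖ ^ 2 - lowLoss lam (S i)| ≤
      3 * B ^ 2 * (C + 1) ^ 2 * aliasError d s N := by
    intro i
    have h1 := sum_norm_mul_sub_sq_le hC hlam (Hs.sum_norm_fourierCoeff_sq_le (hS i).1)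
      (Hs.sum_norm_fourierCoeff_sq_le (hS i).2)
    have h2 := sum_norm_mul_sub_sq_le hC hlam (halias _ (hS i).1) (halias _ (hS i).2)
    rw [← mul_pow] at h1 h2
    refine (abs_sum_norm_sq_sub_le (by positivity) (E := (C + 1) * (aliasError d s N * B))
      (by positivity) h1 (y := fun m : modes d K =>
        lam m * DFT (gridData N S i).1 (-(m : Fin d → ℤ)) -
          DFT (gridData N S i).2 (-(m : Fin d → ℤ))) ?_).trans ?_
    · refine le_trans (le_of_eq (Finset.sum_congr rfl fun m _ => ?_)) h2
      simp only [gridData]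
      congr 2
      ring
    · have h3 : aliasError d s N * (2 + aliasError d s N) ≤ 3 * aliasError d s N := by nlinarith
      have h4 := mul_le_mul_of_nonneg_left h3 (by positivity : 0 ≤ B ^ 2 * (C + 1) ^ 2)
      linarith
  unfold objective
  rw [← mul_sub, ← Finset.sum_sub_distrib, abs_mul, abs_of_pos (one_div_pos.mpr hn0),
    one_div, inv_mul_le_iff₀ hn0]
  refine (Finset.abs_sum_le_sum_abs _ _).trans ((Finset.sum_le_sum fun i _ => key i).trans ?_)
  simp

theorem loss_extendZero_le {d s K : ℕ} (hK : 1 ≤ K) {B C : ℝ} (hC : 0 ≤ C)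
    {lam : modes d K → ℂ} (hlam : ∀ m, ‖lam m‖ ≤ C) {p : Hs d s × Hs d s}
    (hp : p.2.sobolevNorm ≤ B) :
    loss (multiplier (extendZero lam)) p ≤ lowLoss lam p + B ^ 2 * (1 / (K : ℝ) ^ (2 * s)) := by
  classical
  have hK' : (1 : ℝ) ≤ K := by exact_mod_cast hK
  have hpi := Real.pi_gt_three
  set g : (Fin d → ℤ) → ℝ := fun m =>
    if m ∈ modes d K then
      ‖extendZero lam m * fourierCoeff p.1.toL2 m - fourierCoeff p.2.toL2 m‖ ^ 2 else 0 with hg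
  have h1 : HasSum g (lowLoss lam p) := by
    have h : HasSum g (∑ m ∈ modes d K, g m) :=
      hasSum_sum_of_ne_finset_zero fun m hm => by simp [hg, hm]
    convert! h using 1
    rw [← Finset.sum_coe_sort]
    refine Finset.sum_congr rfl fun m _ => ?_
    simp only [hg, m.2, if_true, extendZero_coe]
  have h2 := h1.add (p.2.hasSum_weight.mul_left (1 / (K : ℝ) ^ (2 * s)))
  have h3 := hasSum_le (fun m => ?_) (hasSum_loss (norm_extendZero_le hC hlam) p) h2
  · refine h3.trans ?_
    rw [mul_comm (B ^ 2)]
    have := p.2.sobolevNorm_nonneg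
    gcongr
  · have hw := weight_pos s m
    by_cases hm : m ∈ modes d K
    · simp only [hg, hm, if_true]
      exact le_add_of_nonneg_right (by positivity)
    · simp only [hg, hm, if_false, extendZero_of_notMem lam hm, zero_mul, zero_sub, norm_neg,
        zero_add]
      rw [← mul_assoc, one_div, inv_mul_eq_div]
      refine le_mul_of_one_le_left (sq_nonneg _) ((one_le_div (by positivity)).mpr ?_)
      rw [mem_modes] at hm
      push Not at hm
      obtain ⟨i, hi⟩ := hm
      refine le_trans (pow_le_pow_left₀ (by positivity) ?_ _) (pow_le_weight s m i)
      have h4 : (K : ℝ) ≤ |(m i : ℝ)| := by exact_mod_cast hi.le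
      nlinarith

theorem lowLoss_le_loss {d s K : ℕ} {C : ℝ} {lam : (Fin d → ℤ) → ℂ} (hlam : ∀ m, ‖lam m‖ ≤ C)
    (p : Hs d s × Hs d s) :
    lowLoss (fun m : modes d K => lam m) p ≤ loss (multiplier lam) p := by
  unfold lowLoss
  rw [Finset.sum_coe_sort (modes d K)
    fun m => ‖lam m * fourierCoeff p.1.toL2 m - fourierCoeff p.2.toL2 m‖ ^ 2]
  exact sum_le_hasSum _ (fun _ _ => sq_nonneg _) (hasSum_loss hlam p)

theorem measurable_lowLoss {d s K : ℕ} (lam : modes d K → ℂ) :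
    Measurable (lowLoss lam : Hs d s × Hs d s → ℝ) :=
  Finset.measurable_fun_sum _ fun _ _ => (((Hs.measurable_fourierCoeff_fst _).const_mul _).sub
    (Hs.measurable_fourierCoeff_snd _)).norm.pow_const 2

theorem lowLoss_nonneg {d s K : ℕ} (lam : modes d K → ℂ) (p : Hs d s × Hs d s) :
    0 ≤ lowLoss lam p :=
  Finset.sum_nonneg fun _ _ => sq_nonneg _

theorem integrable_lowLoss {d s K : ℕ} {B C : ℝ} (hC : 0 ≤ C) {lam : modes d K → ℂ}
    (hlam : ∀ m, ‖lam m‖ ≤ C) {μ : Measure (Hs d s × Hs d s)} [IsFiniteMeasure μ]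
    (hμ : ∀ᵐ p ∂μ, p.1.sobolevNorm ≤ B ∧ p.2.sobolevNorm ≤ B) :
    Integrable (lowLoss lam) μ := by
  refine Integrable.of_bound (measurable_lowLoss lam).aestronglyMeasurable
    ((C + 1) ^ 2 * B ^ 2) ?_
  filter_upwards [hμ] with p hp
  rw [Real.norm_of_nonneg (lowLoss_nonneg _ _)]
  exact sum_norm_mul_sub_sq_le hC hlam (Hs.sum_norm_fourierCoeff_sq_le hp.1)
    (Hs.sum_norm_fourierCoeff_sq_le hp.2)

/-! ### The excess risk -/

theorem risk_nonneg {d s : ℕ} (μ : Measure (Hs d s × Hs d s)) (T : L2R d → L2C d) : 0 ≤ risk μ T :=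
  integral_nonneg fun p => loss_nonneg T p

theorem risk_truncatedMultiplier_le {d s n N K : ℕ} (hs : 1 ≤ s) (hds : d ≤ 2 * s) (hn : 1 ≤ n)
    (hK : 1 ≤ K) (hN : 5 ≤ N) (hKN : 2 * K < N) {B C : ℝ} (hB : 0 ≤ B) (hC : 0 ≤ C)
    {μ : Measure (Hs d s × Hs d s)} [IsProbabilityMeasure μ]
    (hμ : ∀ᵐ p ∂μ, p.1.sobolevNorm ≤ B ∧ p.2.sobolevNorm ≤ B)
    {S : Fin n → Hs d s × Hs d s} (hS : ∀ i, (S i).1.sobolevNorm ≤ B ∧ (S i).2.sobolevNorm ≤ B)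
    {lam : modes d K → ℂ} (hlam : IsConstrainedLeastSquares C (gridData N S) lam)
    {lam' : (Fin d → ℤ) → ℂ} (hlam' : ∀ m, ‖lam' m‖ ≤ C) :
    risk μ (truncatedMultiplier lam) ≤ risk μ (multiplier lam') +
      (uniformDeviation K C μ S + 6 * B ^ 2 * (C + 1) ^ 2 * aliasError d s N
        + B ^ 2 * (1 / (K : ℝ) ^ (2 * s))) := by
  obtain ⟨low, hlow, hlowC⟩ : ∃ low : modes d K → ℂ, (∀ m, low m = lam' m) ∧ ∀ m, ‖low m‖ ≤ C :=
    ⟨fun m => lam' m, fun m => rfl, fun m => hlam' m⟩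
  have hi := integrable_lowLoss hC hlam.1 hμ
  have hi' := integrable_lowLoss hC hlowC hμ
  have h1 : risk μ (truncatedMultiplier lam) ≤
      ∫ p, lowLoss lam p ∂μ + B ^ 2 * (1 / (K : ℝ) ^ (2 * s)) := by
    calc risk μ (truncatedMultiplier lam)
        ≤ ∫ p, (lowLoss lam p + B ^ 2 * (1 / (K : ℝ) ^ (2 * s))) ∂μ := by
          rw [truncatedMultiplier_eq]
          refine integral_mono_ae (integrable_loss hC (norm_extendZero_le hC hlam.1) hμ)
            (hi.add (integrable_const _)) ?_
          filter_upwards [hμ] with p hp using loss_extendZero_le hK hC hlam.1 hp.2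
      _ = _ := by
          rw [integral_add hi (integrable_const _)]
          simp
  have h2 : ∫ p, lowLoss low p ∂μ ≤ risk μ (multiplier lam') :=
    integral_mono hi' (integrable_loss hC hlam' hμ) fun p => by
      rw [show low = fun m : modes d K => lam' m from funext hlow]
      exact lowLoss_le_loss hlam' p
  have h3 := lowLoss_deviation_le hμ hlam.1 hlowC S
  rw [integral_sub hi hi', Finset.sum_sub_distrib, mul_sub] at h3
  have h4 := (abs_le.mp (abs_objective_sub_le hs hds hn hN hKN hB hC hS hlam.1)).1
  have h5 := (abs_le.mp (abs_objective_sub_le hs hds hn hN hKN hB hC hS hlowC)).2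
  have h6 := hlam.2 low hlowC
  linarith

theorem excessRisk_multiplierClass_le {d s : ℕ} {C : ℝ} (hC : 0 ≤ C)
    {μ : Measure (Hs d s × Hs d s)} {T : L2R d → L2C d} {R : ℝ}
    (h : ∀ lam : (Fin d → ℤ) → ℂ, (∀ m, ‖lam m‖ ≤ C) → risk μ T ≤ risk μ (multiplier lam) + R) :
    excessRisk μ (multiplierClass d C) T ≤ R := by
  have hne : Nonempty (multiplierClass d C) :=
    ⟨⟨multiplier 0, 0, fun m => by simpa using hC, rfl⟩⟩
  have hle : risk μ T - R ≤ ⨅ T' : multiplierClass d C, risk μ T' := by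
    refine le_ciInf fun T' => ?_
    obtain ⟨lam, hlam, hT'⟩ := T'.2
    rw [hT', sub_le_iff_le_add]
    exact h lam hlam
  unfold excessRisk
  linarith

theorem measurable_risk_truncatedMultiplier {d s K : ℕ} (μ : Measure (Hs d s × Hs d s))
    [IsProbabilityMeasure μ] :
    Measurable fun lam : modes d K → ℂ => risk μ (truncatedMultiplier lam) := by
  have h : Measurable fun x : (modes d K → ℂ) × (Hs d s × Hs d s) =>
      loss (truncatedMultiplier x.1) x.2 := by
    refine measurable_of_hasSum (f := fun m x => ‖extendZero x.1 m * fourierCoeff x.2.1.toL2 m -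
      fourierCoeff x.2.2.toL2 m‖ ^ 2) (fun m => ?_) fun x => ?_
    · have h1 : Measurable fun lam : modes d K → ℂ => extendZero lam m := by
        unfold extendZero
        split_ifs
        · exact measurable_pi_apply _
        · exact measurable_const
      exact (((h1.comp measurable_fst).mul ((Hs.measurable_fourierCoeff_fst m).comp
        measurable_snd)).sub ((Hs.measurable_fourierCoeff_snd m).comp
        measurable_snd)).norm.pow_const 2
    · rw [truncatedMultiplier_eq]
      refine hasSum_loss (C := ∑ m, ‖x.1 m‖) (norm_extendZero_le
        (Finset.sum_nonneg fun m _ => norm_nonneg _) fun m => ?_) x.2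
      exact Finset.single_le_sum (f := fun m => ‖x.1 m‖) (fun m _ => norm_nonneg _)
        (Finset.mem_univ m)
  exact h.stronglyMeasurable.integral_prod_right.measurable

theorem integrable_excessRisk_estimator {d s n N K : ℕ} (hs : 1 ≤ s) {B C : ℝ} (hC : 0 ≤ C)
    {μ : Measure (Hs d s × Hs d s)} [IsProbabilityMeasure μ]
    (hμ : ∀ᵐ p ∂μ, p.1.sobolevNorm ≤ B ∧ p.2.sobolevNorm ≤ B)
    {lamHat : (Fin n → GridFun d N × GridFun d N) → modes d K → ℂ} (hmeas : Measurable lamHat)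
    (hlam : ∀ D m, ‖lamHat D m‖ ≤ C) :
    Integrable (fun S : Fin n → Hs d s × Hs d s =>
      excessRisk μ (multiplierClass d C) (estimator lamHat S)) (Measure.pi fun _ : Fin n => μ) := by
  unfold excessRisk
  refine Integrable.sub ?_ (integrable_const _)
  refine Integrable.of_bound ((measurable_risk_truncatedMultiplier μ).comp
    (hmeas.comp (measurable_gridData hs N))).aestronglyMeasurable (((C + 1) * B) ^ 2)
    (Filter.Eventually.of_forall fun S => ?_)
  have hb := norm_extendZero_le hC (hlam (gridData N S))
  rw [Real.norm_of_nonneg (risk_nonneg _ _), estimator, truncatedMultiplier_eq]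
  calc risk μ (multiplier (extendZero (lamHat (gridData N S))))
      ≤ ∫ _, ((C + 1) * B) ^ 2 ∂μ := by
        refine integral_mono_ae (integrable_loss hC hb hμ) (integrable_const _) ?_
        filter_upwards [hμ] with p hp using loss_le hC hb hp
    _ = _ := by simp

end FourierLearning

theorem theorem1 (d s n N K : ℕ) (hd : 1 ≤ d) (hs : (d : ℝ) / 2 < s) (hn : 1 ≤ n) (hK : 1 ≤ K)
    (hN : max 5 (2 * K) < N) (B C : ℝ) (hB : 0 < B) (hC : 0 < C)
    (μ : Measure (FourierLearning.Hs d s × FourierLearning.Hs d s)) [IsProbabilityMeasure μ]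
    (hμ : ∀ᵐ p ∂μ, p.1.sobolevNorm ≤ B ∧ p.2.sobolevNorm ≤ B)
    (lamHat : (Fin n → FourierLearning.GridFun d N × FourierLearning.GridFun d N) →
      FourierLearning.modes d K → ℂ)
    (hmeas : Measurable lamHat)
    (hmin : ∀ D, FourierLearning.IsConstrainedLeastSquares C D (lamHat D)) :
    (∀ T ∈ FourierLearning.multiplierClass d C, Integrable (FourierLearning.loss T) μ) ∧
    (∀ S : Fin n → FourierLearning.Hs d s × FourierLearning.Hs d s,
      FourierLearning.estimator lamHat S ∈ FourierLearning.multiplierClass d C) ∧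
    Integrable
      (fun S : Fin n → FourierLearning.Hs d s × FourierLearning.Hs d s =>
        FourierLearning.excessRisk μ (FourierLearning.multiplierClass d C)
          (FourierLearning.estimator lamHat S))
      (Measure.pi fun _ : Fin n => μ) ∧
    FourierLearning.expectedExcessRisk n μ (FourierLearning.multiplierClass d C)
        (FourierLearning.estimator lamHat) ≤
      8 * B ^ 2 * (C + 1) ^ 2 *
        (1 / Real.sqrt n + 2 ^ s * Real.sqrt (Real.pi ^ d) / (N : ℝ) ^ s
          + 1 / (K : ℝ) ^ (2 * s)) := by
  open FourierLearning in
  have hs1 : 1 ≤ s := by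
    rcases Nat.eq_zero_or_pos s with rfl | h
    · have : (1 : ℝ) ≤ d := by exact_mod_cast hd
      norm_num at hs
      linarith
    · exact h
  have hds : d ≤ 2 * s := by
    have : (d : ℝ) ≤ 2 * s := by linarith
    exact_mod_cast this
  obtain ⟨hN5, hKN⟩ := max_lt_iff.mp hN
  have hint := integrable_excessRisk_estimator hs1 hC.le hμ hmeas fun D => (hmin D).1
  refine ⟨?_, ?_, hint, ?_⟩
  · rintro _ ⟨lam, hlam, rfl⟩
    exact integrable_loss hC.le hlam hμ
  · exact fun S => ⟨_, norm_extendZero_le hC.le (hmin (gridData N S)).1, truncatedMultiplier_eq _⟩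
  · have hdev := uniformDeviation_integral_le (K := K) hs1 hds hn hC.le hμ
    have hS : ∀ᵐ S ∂(Measure.pi fun _ : Fin n => μ),
        ∀ i, (S i).1.sobolevNorm ≤ B ∧ (S i).2.sobolevNorm ≤ B :=
      ae_all_iff.mpr fun i =>
        (measurePreserving_eval (fun _ : Fin n => μ) i).quasiMeasurePreserving.ae hμ
    have hη := aliasError_le (N := N) hds
    have hη0 := aliasError_nonneg d s N
    have hBC : 0 ≤ B ^ 2 * (C + 1) ^ 2 := by positivity
    have hK0 : 0 ≤ 1 / (K : ℝ) ^ (2 * s) := by positivity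
    calc expectedExcessRisk n μ (multiplierClass d C) (estimator lamHat)
        ≤ ∫ S, (uniformDeviation K C μ S + (6 * B ^ 2 * (C + 1) ^ 2 * aliasError d s N
            + B ^ 2 * (1 / (K : ℝ) ^ (2 * s)))) ∂(Measure.pi fun _ : Fin n => μ) := by
          refine integral_mono_ae hint (hdev.1.add (integrable_const _)) ?_
          filter_upwards [hS] with S hS
          rw [← add_assoc]
          exact excessRisk_multiplierClass_le hC.le fun lam hlam =>
            risk_truncatedMultiplier_le hs1 hds hn hK hN5.le hKN hB.le hC.le hμ hS (hmin _) hlam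
      _ = ∫ S, uniformDeviation K C μ S ∂(Measure.pi fun _ : Fin n => μ)
            + (6 * B ^ 2 * (C + 1) ^ 2 * aliasError d s N + B ^ 2 * (1 / (K : ℝ) ^ (2 * s))) := by
          rw [integral_add hdev.1 (integrable_const _)]
          simp
      _ ≤ 8 * B ^ 2 * (C + 1) ^ 2 * (1 / Real.sqrt n)
            + (8 * B ^ 2 * (C + 1) ^ 2 * (2 ^ s * Real.sqrt (Real.pi ^ d) / (N : ℝ) ^ s)
              + 8 * B ^ 2 * (C + 1) ^ 2 * (1 / (K : ℝ) ^ (2 * s))) := by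
          refine add_le_add hdev.2 (add_le_add ?_ ?_)
          · have := mul_le_mul_of_nonneg_left hη hBC
            have := mul_nonneg hBC hη0
            linarith
          · refine mul_le_mul_of_nonneg_right ?_ hK0
            have : (1 : ℝ) ≤ (C + 1) ^ 2 := one_le_pow₀ (by linarith)
            nlinarith [sq_nonneg B]
      _ = _ := by ring
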